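/- A graph is $d$-degenerate if each of its nonempty induced subgraphs has a vertex of degree at most $d$. A black-and-white graph is a finite simple graph $G=(V,E)$ each of whose vertices is colored black or white. For $a\in\{-1,0,1\}$, a minus-domination of a black-and-white graph (with threshold $a$) is a function $f:V\to\{-1,0,1\}$ such that $f(N[x])=\sum_{y\in N[x]}f(y)>0$ for every black vertex $x$, where $N[x]$ is the closed neighborhood of $x$, and $f(x)\ge a$ for every white vertex $x$. (For $a=-1$ the values of white vertices are unrestricted; for $a=0$ every vertex of value $-1$ is black; for $a=1$ every vertex of value $0$ or $-1$ is black. If all vertices are black, these are the usual minus-domination functions of $G$, for every $a$.) The size of $f$ is the number of vertices $x$ with $f(x)=1$. Theorem. For each $a\in\{-1,0,1\}$ there are an algorithm and a computable function $c:\mathbb{N}^2\to\mathbb{N}$ such that, given $d$, $k\in\mathbb{N}$ and a $d$-degenerate black-and-white graph with $n$ vertices (by adjacency lists), the algorithm outputs a minus-domination with threshold $a$ of size at most $k$ if one exists, and otherwise reports that there is none, in at most $c(d,k)\cdot(n+1)$ steps on a random access machine with addition, truncated subtraction, comparison and indirect addressing, all at unit cost, in which all numbers that are computed are at most $c(d,k)\cdot(n+1)$.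 In particular, for each fixed $d$ and $k$ the algorithm is linear, and the problem is fixed-parameter tractable when parameterized by $d$ and $k$. -/

import Mathlib

namespace MinusDom

/-! ### Graphs -/

open Classical in
/-- `G` is `d`-degenerate: each (nonempty) induced subgraph has a vertex of degree at most `d`. -/
def IsDegenerate {V : Type*} (G : SimpleGraph V) (d : ℕ) : Prop :=
  ∀ S : Finset V, S.Nonempty → ∃ v ∈ S, (S.filter (fun u => G.Adj v u)).card ≤ d

open Classical in
/-- The weight `f(N[x])` of the closed neighborhood of `x`. -/
noncomputable def closedNbhdWeight {V : Type*} [Fintype V] (G : SimpleGraph V)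
    (f : V → SignType) (x : V) : ℤ :=
  ∑ y ∈ Finset.univ.filter (fun y => y = x ∨ G.Adj x y), (f y : ℤ)

/-- Let the vertices in `B` be black and all others white. A function `f : V → {-1, 0, 1}` is a
minus-domination of the black-and-white graph if the closed neighborhood of each black vertex has
positive weight, and each white vertex has a value of at least `a`.
For `a = -1` the values of the white vertices are unrestricted, for `a = 0` all vertices of
value `-1` have to be black, and for `a = 1` all vertices of value `0` or `-1` have to be black.
If all vertices are black then this is a minus-domination function of `G` in the usual sense. -/
def IsMinusDomination {V : Type*} [Fintype V] (a : SignType) (G : SimpleGraph V) (B : Set V)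
    (f : V → SignType) : Prop :=
  (∀ x ∈ B, 0 < closedNbhdWeight G f x) ∧ (∀ x, x ∉ B → a ≤ f x)

/-- The size of `f`: the number of vertices that are assigned `1`. -/
noncomputable def size {V : Type*} (f : V → SignType) : ℕ :=
  {x | f x = 1}.ncard

/-! ### Random access machine -/

/-- Memory: registers and arrays, all of whose cells hold natural numbers. -/
structure State where
  reg : ℕ → ℕ
  arr : ℕ → ℕ → ℕ

/-- The state `s` with the content of register `r` replaced by `v`. -/
def State.setReg (s : State) (r v : ℕ) : State :=
  { s with reg := Function.update s.reg r v }

/-- The state `s` with the content of the cell `i` of array `A` replaced by `v`. -/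
def State.setArr (s : State) (A i v : ℕ) : State :=
  { s with arr := Function.update s.arr A (Function.update (s.arr A) i v) }

/-- Programs of a random access machine with addition, (truncated) subtraction, indirect
addressing and comparison. -/
inductive Prog : Type
  /-- do nothing -/
  | skip : Prog
  /-- `r := c`, for a constant `c` -/
  | const (r c : ℕ) : Prog
  /-- `r := p` -/
  | copy (r p : ℕ) : Prog
  /-- `r := p + q` -/
  | add (r p q : ℕ) : Prog
  /-- `r := max (p - q) 0` -/
  | sub (r p q : ℕ) : Prog
  /-- `r := A[p]`, where the array `A` is fixed in the program -/
  | load (r A p : ℕ) : Prog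
  /-- `A[p] := q`, where the array `A` is fixed in the program -/
  | store (A p q : ℕ) : Prog
  /-- first `P`, then `Q` -/
  | seq (P Q : Prog) : Prog
  /-- if `p < q` then `P` else `Q` -/
  | branch (p q : ℕ) (P Q : Prog) : Prog
  /-- while `p < q` do `P` -/
  | loop (p q : ℕ) (P : Prog) : Prog

/-- `Exec w P s s' t`: started in state `s`, the program `P` halts in state `s'` after exactly `t`
steps, on a machine whose words hold the numbers `0, …, w`. Each instruction and each evaluation of
a test takes one step. An instruction that would produce a number that exceeds `w` cannot be
executed. -/
inductive Exec (w : ℕ) : Prog → State → State → ℕ → Prop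
  | skip (s : State) : Exec w .skip s s 1
  | const (s : State) (r c : ℕ) (h : c ≤ w) :
      Exec w (.const r c) s (s.setReg r c) 1
  | copy (s : State) (r p : ℕ) :
      Exec w (.copy r p) s (s.setReg r (s.reg p)) 1
  | add (s : State) (r p q : ℕ) (h : s.reg p + s.reg q ≤ w) :
      Exec w (.add r p q) s (s.setReg r (s.reg p + s.reg q)) 1
  | sub (s : State) (r p q : ℕ) :
      Exec w (.sub r p q) s (s.setReg r (s.reg p - s.reg q)) 1
  | load (s : State) (r A p : ℕ) :
      Exec w (.load r A p) s (s.setReg r (s.arr A (s.reg p))) 1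
  | store (s : State) (A p q : ℕ) :
      Exec w (.store A p q) s (s.setArr A (s.reg p) (s.reg q)) 1
  | seq {P Q : Prog} {s₁ s₂ s₃ : State} {t₁ t₂ : ℕ} :
      Exec w P s₁ s₂ t₁ → Exec w Q s₂ s₃ t₂ → Exec w (.seq P Q) s₁ s₃ (t₁ + t₂)
  | branch_true {P Q : Prog} {s s' : State} {p q t : ℕ} :
      s.reg p < s.reg q → Exec w P s s' t → Exec w (.branch p q P Q) s s' (t + 1)
  | branch_false {P Q : Prog} {s s' : State} {p q t : ℕ} :
      ¬ s.reg p < s.reg q → Exec w Q s s' t → Exec w (.branch p q P Q) s s' (t + 1)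
  | loop_true {P : Prog} {s₁ s₂ s₃ : State} {p q t₁ t₂ : ℕ} :
      s₁.reg p < s₁.reg q → Exec w P s₁ s₂ t₁ → Exec w (.loop p q P) s₂ s₃ t₂ →
        Exec w (.loop p q P) s₁ s₃ (t₁ + t₂ + 1)
  | loop_false {P : Prog} {s : State} {p q : ℕ} :
      ¬ s.reg p < s.reg q → Exec w (.loop p q P) s s 1

/-- The machine is deterministic: the final state and the number of steps of a halting computation
are determined by the program and by the initial state. -/
theorem Exec.deterministic {w : ℕ} {P : Prog} {s s₁ s₂ : State} {t₁ t₂ : ℕ}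
    (h₁ : Exec w P s s₁ t₁) (h₂ : Exec w P s s₂ t₂) : s₁ = s₂ ∧ t₁ = t₂ := by
  induction h₁ generalizing s₂ t₂ with
  | skip => cases h₂; exact ⟨rfl, rfl⟩
  | const => cases h₂; exact ⟨rfl, rfl⟩
  | copy => cases h₂; exact ⟨rfl, rfl⟩
  | add => cases h₂; exact ⟨rfl, rfl⟩
  | sub => cases h₂; exact ⟨rfl, rfl⟩
  | load => cases h₂; exact ⟨rfl, rfl⟩
  | store => cases h₂; exact ⟨rfl, rfl⟩
  | seq _ _ ih₁ ih₂ =>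
    cases h₂ with
    | seq a b =>
      obtain ⟨rfl, rfl⟩ := ih₁ a
      obtain ⟨rfl, rfl⟩ := ih₂ b
      exact ⟨rfl, rfl⟩
  | branch_true hc _ ih =>
    cases h₂ with
    | branch_true _ b => obtain ⟨rfl, rfl⟩ := ih b; exact ⟨rfl, rfl⟩
    | branch_false hn _ => exact absurd hc hn
  | branch_false hc _ ih =>
    cases h₂ with
    | branch_true hn _ => exact absurd hn hc
    | branch_false _ b => obtain ⟨rfl, rfl⟩ := ih b; exact ⟨rfl, rfl⟩
  | loop_true hc _ _ ih₁ ih₂ =>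
    cases h₂ with
    | loop_true _ a b =>
      obtain ⟨rfl, rfl⟩ := ih₁ a
      obtain ⟨rfl, rfl⟩ := ih₂ b
      exact ⟨rfl, rfl⟩
    | loop_false hn => exact absurd hc hn
  | loop_false hc =>
    cases h₂ with
    | loop_true hn _ _ => exact absurd hn hc
    | loop_false _ => exact ⟨rfl, rfl⟩

/-! ### Input and output -/

/-- An adjacency-list representation of a graph with vertices `0, …, n - 1`: for each vertex a list
of its neighbors, in any order and without repetitions. -/
structure AdjList {n : ℕ} (G : SimpleGraph (Fin n)) where
  nbrs : Fin n → List (Fin n)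
  nodup : ∀ v, (nbrs v).Nodup
  mem_iff : ∀ v u, u ∈ nbrs v ↔ G.Adj v u

open Classical in
/-- The initial state for the input `d`, `k`, `G`, `B`. The registers `0`, `1`, `2` hold `n`, `k`
and `d`. Array `1` holds the concatenation of the adjacency lists of the vertices `0, …, n - 1`, and
the cells `v` and `v + 1` of array `0` hold the positions in array `1` where the adjacency list of
`v` starts and where it has ended. Cell `v` of array `2` holds `1` if `v` is black and `0` if `v` is
white. All other cells hold `0`. -/
noncomputable def initState (d k : ℕ) {n : ℕ} {G : SimpleGraph (Fin n)} (L : AdjList G)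
    (B : Set (Fin n)) : State where
  reg r := if r = 0 then n else if r = 1 then k else if r = 2 then d else 0
  arr A i :=
    if A = 0 then
      if i ≤ n then ∑ u ∈ Finset.univ.filter (fun u : Fin n => u.val < i), (L.nbrs u).length else 0
    else if A = 1 then
      (((List.finRange n).flatMap L.nbrs).map Fin.val).getD i 0
    else if A = 2 then
      if ∃ h : i < n, (⟨i, h⟩ : Fin n) ∈ B then 1 else 0
    else 0

/-- The answer in the final state `s` is correct. Either register `0` holds `1`, and the cells
`0, …, n - 1` of array `3` hold the values, increased by one, of a minus-domination of size at
most `k`; or register `0` holds `0`, and there is no such minus-domination. -/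
def CorrectOutput (a : SignType) (k : ℕ) {n : ℕ} (G : SimpleGraph (Fin n)) (B : Set (Fin n))
    (s : State) : Prop :=
  (s.reg 0 = 1 ∧ ∃ f : Fin n → SignType, IsMinusDomination a G B f ∧ size f ≤ k ∧
      ∀ v : Fin n, (s.arr 3 v : ℤ) = (f v : ℤ) + 1) ∨
  (s.reg 0 = 0 ∧ ¬ ∃ f : Fin n → SignType, IsMinusDomination a G B f ∧ size f ≤ k)

end MinusDom

/-! The value `-1` never helps. A positive sum over `N[x]` has a summand `1`, so the set `D` of
vertices of value `1` meets the closed neighborhood of each black vertex; for `a = 1` it also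
contains every white vertex. Conversely, the 0-1 indicator of any set with these properties is a
minus-domination, because white vertices may have value `0` unless `a = 1`. What remains is a
domination problem with at most `k` chosen vertices (`exists_dominating`,
`isMinusDomination_of_dominating`).

Degeneracy enters only through the absence of `K_{d+1,d+1}`. Let `M = (k+1)(d+1)`, let `S` be the
set chosen so far, and compare vertices by their traces on the first `M` pending vertices, encoded
as masks below `2 ^ M`. If more than `M` vertices are pending, then by pigeonhole some vertex of `D`
dominates at least `d + 1` of the first `M`. At most `2d + 1` vertices share its trace, so its mask
and its position among the vertices with that mask identify it. If at most `M` vertices are pending,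
then vertices with equal masks are interchangeable, and the first one will do. Either way two digits
in base `2 ^ M` describe a good next vertex (`exists_digits`), and if there is a solution, some
number below `2 ^ (2Mk)` encodes a successful search of `k` steps (`exists_iterate`).

The program tries all these numbers and checks each outcome, so that wrong guesses do no harm. One
step reads at most `M + 1` adjacency lists, each of length at most `n`; hence the time is linear in
`n`, whatever the number of edges. -/

namespace MinusDom

open Finset

/-! ### Domination problems and their trace masks -/

/-- A graph on `0, …, n - 1` without `K_{d+1,d+1}`, given by lists of neighbors, with black
vertices and a set of vertices that have to be dominated. -/
structure Net (n d : ℕ) where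
  nb : ℕ → List ℕ
  black : ℕ → Prop
  need : ℕ → Prop
  nodup : ∀ v, (nb v).Nodup
  lt : ∀ v u, u ∈ nb v → u < n
  symm : ∀ v u, u ∈ nb v → v ∈ nb u
  irrefl : ∀ v, v ∉ nb v
  biclique : ∀ X Y : Finset ℕ, Disjoint X Y → d + 1 ≤ #X → d + 1 ≤ #Y →
    ¬ ∀ x ∈ X, ∀ y ∈ Y, x ∈ nb y

namespace Net

variable {n d : ℕ} (N : Net n d)

/-- Choosing `y` satisfies the demand of `v`: black vertices are dominated by their neighbors,
and every vertex is dominated by itself. -/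
def Sat (y v : ℕ) : Prop := y = v ∨ (N.black v ∧ y ∈ N.nb v)

/-- The vertex `v` has to be dominated and is not dominated by `S`. -/
def Pending (S : Finset ℕ) (v : ℕ) : Prop := v < n ∧ N.need v ∧ ∀ y ∈ S, ¬ N.Sat y v

open Classical in
/-- The number of pending vertices below `j`. -/
noncomputable def rank (S : Finset ℕ) (j : ℕ) : ℕ := #{u ∈ range j | N.Pending S u}

open Classical in
/-- Part of the mask of `v` that comes from pending vertices below `j`. -/
noncomputable def maskUpTo (M : ℕ) (S : Finset ℕ) (j v : ℕ) : ℕ :=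
  ∑ u ∈ range j, if N.Pending S u ∧ N.rank S u < M ∧ N.Sat v u then 2 ^ N.rank S u else 0

/-- The mask of `v` encodes which of the first `M` pending vertices are dominated by `v`. -/
noncomputable def mask (M : ℕ) (S : Finset ℕ) (v : ℕ) : ℕ := N.maskUpTo M S n v

end Net

/-- Scan of `0, …, j - 1` for the `c`-th position with `W = m`: the position (or `n`) and what
remains of `c`. -/
def scan (W : ℕ → ℕ) (m n c : ℕ) : ℕ → ℕ × ℕ
  | 0 => (n, c)
  | j + 1 => if W j = m ∧ 0 < (scan W m n c j).2 then (j, (scan W m n c j).2 - 1)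
      else scan W m n c j

/-- Every hit uses up one unit of the counter until nothing is left; truncated subtraction covers
both phases. -/
theorem scan_snd (W : ℕ → ℕ) (m n c j : ℕ) :
    (scan W m n c j).2 = c - #{u ∈ range j | W u = m} := by
  induction j with
  | zero => simp [scan]
  | succ j ih =>
    rw [scan, range_add_one, filter_insert]
    by_cases h : W j = m
    · rw [if_pos h, card_insert_of_notMem (by simp)]
      split_ifs <;> simp_all <;> omega
    · simp [h, ih]

/-- The counter is still `1` on arrival at `v` and `0` afterwards, so that later hits do not
overwrite the result. -/
theorem scan_fst (W : ℕ → ℕ) (n v : ℕ) (i : ℕ) :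
    (scan W (W v) n #{u ∈ range (v + 1) | W u = W v} (v + 1 + i)).1 = v := by
  induction i with
  | zero =>
    have h : #{u ∈ range (v + 1) | W u = W v} = #{u ∈ range v | W u = W v} + 1 := by
      rw [range_add_one, filter_insert, if_pos rfl, card_insert_of_notMem (by simp)]
    have h0 : 0 < (scan W (W v) n #{u ∈ range (v + 1) | W u = W v} v).2 := by
      rw [scan_snd, h]; omega
    rw [Nat.add_zero, scan, if_pos ⟨rfl, h0⟩]
  | succ i ih =>
    rw [← Nat.add_assoc, scan, if_neg, ih]
    rintro ⟨-, h⟩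
    rw [scan_snd] at h
    have : #{u ∈ range (v + 1) | W u = W v} ≤ #{u ∈ range (v + 1 + i) | W u = W v} :=
      card_le_card (filter_subset_filter _ (range_subset_range.2 (by omega)))
    omega

theorem scan_eq (W : ℕ → ℕ) {n v : ℕ} (hv : v < n) :
    (scan W (W v) n #{u ∈ range (v + 1) | W u = W v} n).1 = v := by
  obtain ⟨i, rfl⟩ := Nat.exists_eq_add_of_lt hv
  rw [show v + i + 1 = v + 1 + i by omega]
  exact scan_fst W _ v i

/-! ### Ranks and masks: traces on the first pending vertices -/

namespace Net

variable {n d : ℕ} (N : Net n d)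

open Classical in
theorem rank_succ (S : Finset ℕ) (j : ℕ) :
    N.rank S (j + 1) = N.rank S j + if N.Pending S j then 1 else 0 := by
  rw [rank, rank, range_add_one, filter_insert]
  split_ifs with h
  · rw [card_insert_of_notMem (by simp)]
  · simp

theorem rank_mono (S : Finset ℕ) : Monotone (N.rank S) :=
  monotone_nat_of_le_succ fun j => by rw [rank_succ]; omega

theorem rank_lt_rank {S : Finset ℕ} {u v : ℕ} (hu : N.Pending S u) (h : u < v) :
    N.rank S u < N.rank S v := by
  have := N.rank_mono S (show u + 1 ≤ v from h)
  rw [rank_succ, if_pos hu] at this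
  omega

/-- Different pending vertices occupy different bits of a mask. -/
theorem rank_injOn (S : Finset ℕ) : Set.InjOn (N.rank S) {u | N.Pending S u} := by
  intro u hu v hv h
  rcases lt_trichotomy u v with h1 | h1 | h1
  · have := N.rank_lt_rank hu h1; omega
  · exact h1
  · have := N.rank_lt_rank hv h1; omega

open Classical in
/-- The first `M` pending vertices, as far as they are below `j`. -/
noncomputable def firstUpTo (M : ℕ) (S : Finset ℕ) (j : ℕ) : Finset ℕ :=
  {u ∈ range j | N.Pending S u ∧ N.rank S u < M}

theorem card_firstUpTo (M : ℕ) (S : Finset ℕ) (j : ℕ) :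
    #(N.firstUpTo M S j) = min (N.rank S j) M := by
  classical
  induction j with
  | zero =>
    rw [show N.rank S 0 = 0 by simp [rank], Nat.zero_min, card_eq_zero,
      eq_empty_iff_forall_notMem]
    simp [firstUpTo]
  | succ j ih =>
    rw [rank_succ, firstUpTo, range_add_one, filter_insert]
    rw [firstUpTo] at ih
    by_cases h : N.Pending S j
    · by_cases h2 : N.rank S j < M
      · rw [if_pos ⟨h, h2⟩, card_insert_of_notMem (by simp), if_pos h, ih]; omega
      · rw [if_neg (by tauto), if_pos h, ih]; omega
    · rw [if_neg (by tauto), if_neg h, ih]; omega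

theorem mem_firstUpTo {M : ℕ} {S : Finset ℕ} {u : ℕ} :
    u ∈ N.firstUpTo M S n ↔ N.Pending S u ∧ N.rank S u < M := by
  simp only [firstUpTo, mem_filter, mem_range, and_iff_right_iff_imp]
  exact fun h => h.1.1

-- As a sum of distinct powers of two, a mask determines the set of its exponents, and with it the
-- trace.
open Classical in
theorem maskUpTo_eq (M : ℕ) (S : Finset ℕ) (j v : ℕ) :
    N.maskUpTo M S j v =
      ∑ i ∈ ((N.firstUpTo M S j).filter (N.Sat v)).image (N.rank S), 2 ^ i := by
  rw [sum_image, maskUpTo, firstUpTo, filter_filter, sum_filter]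
  · simp only [and_assoc]
  · intro u hu v hv h
    simp only [firstUpTo, coe_filter, mem_filter, mem_range, Set.mem_ofPred_eq] at hu hv
    exact N.rank_injOn S hu.1.2.1 hv.1.2.1 h

theorem maskUpTo_lt (M : ℕ) (S : Finset ℕ) (j v : ℕ) :
    N.maskUpTo M S j v < 2 ^ min (N.rank S j) M := by
  classical
  rw [maskUpTo_eq]
  refine Nat.geomSum_lt le_rfl fun i hi => ?_
  simp only [firstUpTo, mem_image, mem_filter, mem_range] at hi
  obtain ⟨u, ⟨⟨hu, h1, h2⟩, -⟩, rfl⟩ := hi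
  exact lt_min (N.rank_lt_rank h1 hu) h2

theorem mask_lt (M : ℕ) (S : Finset ℕ) (v : ℕ) : N.mask M S v < 2 ^ M :=
  (N.maskUpTo_lt M S n v).trans_le (Nat.pow_le_pow_right (by omega) (min_le_right _ _))

/-- Uniqueness of binary expansions gives equal sets of ranks, and ranks are injective on pending
vertices. -/
theorem sat_of_mask_eq {M : ℕ} {S : Finset ℕ} {v v' u : ℕ} (h : N.mask M S v = N.mask M S v')
    (hu : u ∈ N.firstUpTo M S n) (hs : N.Sat v u) : N.Sat v' u := by
  classical
  rw [mask, mask, maskUpTo_eq, maskUpTo_eq] at h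
  have h := geomSum_injective le_rfl h
  have : N.rank S u ∈ ((N.firstUpTo M S n).filter (N.Sat v')).image (N.rank S) := by
    rw [← h]
    exact mem_image_of_mem _ (mem_filter.2 ⟨hu, hs⟩)
  obtain ⟨u', hu', he⟩ := mem_image.1 this
  rw [mem_filter] at hu'
  rw [mem_firstUpTo] at hu hu'
  rw [← N.rank_injOn S hu'.1.1 hu.1 he]
  exact hu'.2

/-- One step of the search: the next vertex is determined by the digits of `x` in base `2 ^ M`. -/
noncomputable def step (M : ℕ) (p : Finset ℕ × ℕ) : Finset ℕ × ℕ :=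
  (let y := (scan (N.mask M p.1) (p.2 % 2 ^ M) n (p.2 / 2 ^ M % 2 ^ M) n).1
   if y < n then insert y p.1 else p.1, p.2 / 2 ^ M / 2 ^ M)

/-! ### The guessed search and its completeness -/

theorem step_superset (M : ℕ) (p : Finset ℕ × ℕ) : p.1 ⊆ (N.step M p).1 := by
  simp only [step]
  split_ifs
  · exact subset_insert _ _
  · exact Subset.rfl

theorem iterate_step_superset (M i : ℕ) (p : Finset ℕ × ℕ) : p.1 ⊆ ((N.step M)^[i] p).1 := by
  induction i with
  | zero => exact Subset.rfl
  | succ i ih =>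
    rw [Function.iterate_succ_apply']
    exact ih.trans (N.step_superset M _)

theorem card_step_le (M : ℕ) (p : Finset ℕ × ℕ) : #(N.step M p).1 ≤ #p.1 + 1 := by
  simp only [step]
  split_ifs with h
  · exact card_insert_le _ _
  · omega

/-- This is why a set found in `k` steps respects the bound on the size. -/
theorem card_iterate_step_le (M i x : ℕ) : #((N.step M)^[i] (∅, x)).1 ≤ i := by
  induction i with
  | zero => simp
  | succ i ih =>
    rw [Function.iterate_succ_apply']
    exact (N.card_step_le M _).trans (by omega)

/-- Few vertices have the same trace if that trace is large. -/
theorem card_le_of_common_trace {X Y : Finset ℕ} (h : ∀ x ∈ X, ∀ y ∈ Y, N.Sat x y)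
    (hY : d + 1 ≤ #Y) : #X ≤ 2 * d + 1 := by
  by_contra! hX
  -- With exactly `d + 1` vertices in `Y'`, removing them from the at least `2d + 2` vertices of `X`
  -- leaves `d + 1`. Outside of `Y'`, satisfying a demand in `Y'` means adjacency.
  obtain ⟨Y', hY', hc⟩ := exists_subset_card_eq hY
  refine N.biclique (X \ Y') Y' sdiff_disjoint ?_ hc.ge ?_
  · have := le_card_sdiff Y' X
    omega
  · intro x hx y hy
    rw [mem_sdiff] at hx
    rcases h x hx.1 y (hY' hy) with rfl | h
    · exact absurd hy hx.2
    · exact h.2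

/-- The position among at most `2d + 1` vertices of equal mask fits into one digit. -/
theorem two_mul_lt_two_pow {d M : ℕ} (h : d + 1 ≤ M) : 2 * d + 1 < 2 ^ M := by
  have h1 : d < 2 ^ d := Nat.lt_two_pow_self
  have h2 : 2 ^ (d + 1) ≤ 2 ^ M := Nat.pow_le_pow_right (by omega) h
  rw [pow_succ] at h2
  omega

/-- If `D` dominates all pending vertices, then some vertex of `D` may be replaced by one that a
suitable choice of two digits selects. -/
theorem exists_digits {k M : ℕ} (hM : (k + 1) * (d + 1) ≤ M) {S D : Finset ℕ} (hD : D ⊆ range n)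
    (hk : #D ≤ k) (hcov : ∀ v, N.Pending S v → ∃ y ∈ D, N.Sat y v)
    (hne : ∃ v, N.Pending S v) :
    ∃ m < 2 ^ M, ∃ c < 2 ^ M, ∃ y₀ ∈ D, ∃ y < n, (scan (N.mask M S) m n c n).1 = y ∧
      ∀ v, N.Pending S v → N.Sat y₀ v → N.Sat y v := by
  classical
  have hdM : d + 1 ≤ M := le_trans (Nat.le_mul_of_pos_left _ (by omega)) hM
  -- With at most `M` pending vertices the mask records all demands, so the first vertex with the
  -- mask of `y₀` can replace `y₀`.
  by_cases hr : N.rank S n ≤ M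
  · obtain ⟨v, hv⟩ := hne
    obtain ⟨y₀, hy₀, -⟩ := hcov v hv
    have hex : ∃ y, y < n ∧ N.mask M S y = N.mask M S y₀ := ⟨y₀, mem_range.1 (hD hy₀), rfl⟩
    obtain ⟨hy, hm⟩ := Nat.find_spec hex
    set y := Nat.find hex with hydef
    -- As the least vertex with its mask, `y` has position `1`.
    have hc : #{u ∈ range (y + 1) | N.mask M S u = N.mask M S y} = 1 := by
      rw [card_eq_one]
      refine ⟨y, ?_⟩
      ext u
      simp only [mem_filter, mem_range, mem_singleton]
      refine ⟨fun hu => ?_, fun hu => by subst hu; simp⟩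
      by_contra hne
      exact Nat.find_min hex (m := u) (by omega) ⟨by omega, hu.2.trans hm⟩
    have hs := scan_eq (N.mask M S) hy
    rw [hc] at hs
    refine ⟨_, N.mask_lt M S y, 1, by have := two_mul_lt_two_pow hdM; omega, y₀, hy₀, y, hy, hs, ?_⟩
    intro u hu h
    refine N.sat_of_mask_eq hm.symm (N.mem_firstUpTo.2 ⟨hu, ?_⟩) h
    exact (N.rank_lt_rank hu hu.1).trans_le hr
  · have hF : #(N.firstUpTo M S n) = M := by rw [card_firstUpTo]; omega
    -- Pigeonhole: if each vertex of `D` dominated at most `d` of these `M` vertices, then `M ≤ k *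
    -- d < (k + 1) * (d + 1)`.
    obtain ⟨y₀, hy₀, ht⟩ : ∃ y ∈ D, d + 1 ≤ #((N.firstUpTo M S n).filter (N.Sat y)) := by
      by_contra! hcon
      have h1 : N.firstUpTo M S n ⊆ D.biUnion fun y => (N.firstUpTo M S n).filter (N.Sat y) := by
        intro u hu
        obtain ⟨y, hy, hyu⟩ := hcov u (N.mem_firstUpTo.1 hu).1
        exact mem_biUnion.2 ⟨y, hy, mem_filter.2 ⟨hu, hyu⟩⟩
      have h2 := (card_le_card h1).trans (card_biUnion_le_card_mul D _ d
        fun y hy => by have := hcon y hy; omega)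
      have h3 : #D * d ≤ k * d := Nat.mul_le_mul_right d hk
      nlinarith
    have hy := mem_range.1 (hD hy₀)
    -- Here no replacement takes place: the second digit is the position of `y₀` itself.
    refine ⟨_, N.mask_lt M S y₀, _, ?_, y₀, hy₀, y₀, hy, scan_eq (N.mask M S) hy,
      fun v _ h => h⟩
    refine lt_of_le_of_lt (N.card_le_of_common_trace (Y := (N.firstUpTo M S n).filter (N.Sat y₀))
      ?_ ht) (two_mul_lt_two_pow hdM)
    intro x hx u hu
    exact N.sat_of_mask_eq (mem_filter.1 hx).2.symm (mem_filter.1 hu).1 (mem_filter.1 hu).2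

theorem Pending.mono {S S' : Finset ℕ} (h : S ⊆ S') {v : ℕ} (hv : N.Pending S' v) :
    N.Pending S v := ⟨hv.1, hv.2.1, fun y hy => hv.2.2 y (h hy)⟩

/-- The search is complete. -/
theorem exists_iterate {k M : ℕ} (hM : (k + 1) * (d + 1) ≤ M) (j : ℕ) (hj : j ≤ k) :
    ∀ S D : Finset ℕ, D ⊆ range n → #D ≤ j → (∀ v, N.Pending S v → ∃ y ∈ D, N.Sat y v) →
      ∃ x < 2 ^ (M * (2 * j)), ∀ v, ¬ N.Pending ((N.step M)^[j] (S, x)).1 v := by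
  induction j with
  | zero =>
    intro S D _ hc hcov
    refine ⟨0, by simp, fun v hv => ?_⟩
    obtain ⟨y, hy, -⟩ := hcov v hv
    simp_all
  | succ j ih =>
    intro S D hD hc hcov
    by_cases hne : ∃ v, N.Pending S v
    · obtain ⟨m, hm, c, hc', y₀, hy₀, y, hy, hs, hrep⟩ :=
        N.exists_digits hM hD (hc.trans hj) hcov hne
      have hcov' : ∀ v, N.Pending (insert y S) v → ∃ y ∈ D.erase y₀, N.Sat y v := by
        intro v hv
        have hvS := Pending.mono N (subset_insert y S) hv
        obtain ⟨y', hy', hsat⟩ := hcov v hvS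
        refine ⟨y', mem_erase.2 ⟨?_, hy'⟩, hsat⟩
        rintro rfl
        exact hv.2.2 y (mem_insert_self _ _) (hrep v hvS hsat)
      obtain ⟨x, hx, hfin⟩ := ih (by omega) (insert y S) (D.erase y₀)
        ((erase_subset _ _).trans hD) (by rw [card_erase_of_mem hy₀]; omega) hcov'
      -- The two digits for the present step are the lowest ones; `x` encodes the later steps.
      refine ⟨m + 2 ^ M * (c + 2 ^ M * x), ?_, ?_⟩
      · have h1 : 2 ^ (M * (2 * (j + 1))) = 2 ^ M * (2 ^ M * 2 ^ (M * (2 * j))) := by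
          rw [← pow_add, ← pow_add]; congr 1; ring
        rw [h1]
        have h2 : c + 2 ^ M * x < 2 ^ M * 2 ^ (M * (2 * j)) := by
          have := Nat.mul_le_mul_left (2 ^ M) (Nat.succ_le_of_lt hx)
          rw [Nat.mul_succ] at this
          omega
        have := Nat.mul_le_mul_left (2 ^ M) (Nat.succ_le_of_lt h2)
        rw [Nat.mul_succ] at this
        omega
      · rw [Function.iterate_succ_apply]
        have h0 : 0 < 2 ^ M := by positivity
        have e1 : (m + 2 ^ M * (c + 2 ^ M * x)) % 2 ^ M = m := by
          rw [Nat.add_mul_mod_self_left, Nat.mod_eq_of_lt hm]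
        have e2 : (m + 2 ^ M * (c + 2 ^ M * x)) / 2 ^ M = c + 2 ^ M * x := by
          rw [Nat.add_mul_div_left _ _ h0, Nat.div_eq_of_lt hm, Nat.zero_add]
        have e3 : (c + 2 ^ M * x) % 2 ^ M = c := by
          rw [Nat.add_mul_mod_self_left, Nat.mod_eq_of_lt hc']
        have e4 : (c + 2 ^ M * x) / 2 ^ M = x := by
          rw [Nat.add_mul_div_left _ _ h0, Nat.div_eq_of_lt hc', Nat.zero_add]
        have e5 : N.step M (S, m + 2 ^ M * (c + 2 ^ M * x)) = (insert y S, x) := by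
          simp only [step, e1, e2, e3, e4, hs, if_pos hy]
        rw [e5]
        exact hfin
    -- Nothing is pending any more, and further steps only enlarge the set, so any number works.
    · refine ⟨0, by positivity, fun v hv => hne ⟨v, ?_⟩⟩
      exact Pending.mono N (N.iterate_step_superset M _ (S, 0)) hv

end Net

/-! ### Minus-dominations and domination problems -/

section Bridge

variable {n d k : ℕ} {G : SimpleGraph (Fin n)}

/-- Otherwise every vertex of the subgraph induced by `X ∪ Y` would have degree at least `d + 1`. -/
theorem IsDegenerate.not_biclique (hG : IsDegenerate G d) (X Y : Finset (Fin n))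
    (hX : d + 1 ≤ #X) (hY : d + 1 ≤ #Y) : ¬ ∀ x ∈ X, ∀ y ∈ Y, G.Adj x y := by
  classical
  intro h
  obtain ⟨v, hv, hc⟩ := hG (X ∪ Y) ((card_pos.1 (by omega : 0 < #X)).mono subset_union_left)
  rcases mem_union.1 hv with hv | hv
  · have : Y ⊆ (X ∪ Y).filter (fun u => G.Adj v u) := fun y hy =>
      mem_filter.2 ⟨mem_union_right _ hy, h v hv y hy⟩
    have := card_le_card this
    have hcc : #((X ∪ Y).filter (fun u => G.Adj v u)) ≤ d := by convert hc
    omega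
  · have : X ⊆ (X ∪ Y).filter (fun u => G.Adj v u) := fun x hx =>
      mem_filter.2 ⟨mem_union_left _ hx, (h x hx v hv).symm⟩
    have := card_le_card this
    have hcc : #((X ∪ Y).filter (fun u => G.Adj v u)) ≤ d := by convert hc
    omega

/-- The adjacency list of `v` as a list of numbers. -/
def AdjList.natNbrs (L : AdjList G) (v : ℕ) : List ℕ :=
  if h : v < n then (L.nbrs ⟨v, h⟩).map Fin.val else []

theorem AdjList.mem_natNbrs {L : AdjList G} {v u : ℕ} :
    u ∈ L.natNbrs v ↔ ∃ (hv : v < n) (hu : u < n), G.Adj ⟨v, hv⟩ ⟨u, hu⟩ := by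
  unfold natNbrs
  split_ifs with h
  · simp only [List.mem_map, L.mem_iff]
    constructor
    · rintro ⟨a, ha, rfl⟩
      exact ⟨h, a.2, ha⟩
    · rintro ⟨_, hu, ha⟩
      exact ⟨⟨u, hu⟩, ha, rfl⟩
  · simp [h]

/-- The domination problem that belongs to a black-and-white graph and a threshold. -/
def netOf (a : SignType) (B : Set (Fin n)) (L : AdjList G) (hG : IsDegenerate G d) :
    Net n d where
  nb := L.natNbrs
  black v := ∃ h : v < n, (⟨v, h⟩ : Fin n) ∈ B
  need v := (∃ h : v < n, (⟨v, h⟩ : Fin n) ∈ B) ∨ a = 1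
  nodup v := by
    unfold AdjList.natNbrs
    split_ifs
    · exact (L.nodup _).map Fin.val_injective
    · exact List.nodup_nil
  lt v u h := (AdjList.mem_natNbrs.1 h).2.1
  symm v u h := by
    obtain ⟨hv, hu, ha⟩ := AdjList.mem_natNbrs.1 h
    exact AdjList.mem_natNbrs.2 ⟨hu, hv, ha.symm⟩
  irrefl v h := by
    obtain ⟨hv, hu, ha⟩ := AdjList.mem_natNbrs.1 h
    exact ha.ne rfl
  biclique X Y _ hX hY h := by
    have hne : ∀ Z : Finset ℕ, d + 1 ≤ #Z → ∃ z, z ∈ Z := fun Z hZ =>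
      card_pos.1 (by omega : 0 < #Z)
    have hXn : ∀ x ∈ X, x < n := fun x hx => by
      obtain ⟨y, hy⟩ := hne Y hY
      exact (AdjList.mem_natNbrs.1 (h x hx y hy)).2.1
    have hYn : ∀ y ∈ Y, y < n := fun y hy => by
      obtain ⟨x, hx⟩ := hne X hX
      exact (AdjList.mem_natNbrs.1 (h x hx y hy)).1
    refine hG.not_biclique (X.attachFin hXn) (Y.attachFin hYn) (by simpa) (by simpa) ?_
    intro x hx y hy
    obtain ⟨_, _, ha⟩ := AdjList.mem_natNbrs.1 (h x (by simpa using hx) y (by simpa using hy))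
    exact ha.symm

variable {a : SignType} {B : Set (Fin n)} {L : AdjList G} {hG : IsDegenerate G d}

/-- `D` is the set of vertices of value `1`: a positive sum has a positive summand, and `1` is the
only positive sign. For `a = 1` white vertices have value `1` and dominate themselves. -/
theorem exists_dominating {f : Fin n → SignType} (hf : IsMinusDomination a G B f)
    (hs : size f ≤ k) :
    ∃ D ⊆ range n, #D ≤ k ∧ ∀ v, (netOf a B L hG).Pending ∅ v → ∃ y ∈ D,
      (netOf a B L hG).Sat y v := by
  classical
  refine ⟨((univ : Finset (Fin n)).filter (fun v => f v = 1)).image Fin.val, ?_, ?_, ?_⟩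
  · intro x hx
    obtain ⟨y, -, rfl⟩ := mem_image.1 hx
    exact mem_range.2 y.2
  · refine card_image_le.trans (le_of_eq_of_le ?_ hs)
    rw [size, Set.ncard_eq_toFinset_card']
    congr 1
    ext; simp
  · rintro v ⟨hv, hneed, -⟩
    by_cases hB : (⟨v, hv⟩ : Fin n) ∈ B
    · have hpos := hf.1 _ hB
      unfold closedNbhdWeight at hpos
      obtain ⟨y, hy, hy0⟩ := exists_lt_of_sum_lt (s := univ.filter
        (fun y : Fin n => y = ⟨v, hv⟩ ∨ G.Adj ⟨v, hv⟩ y)) (f := fun _ => (0 : ℤ))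
        (g := fun y => (f y : ℤ)) (by
          rw [sum_const_zero]
          refine lt_of_lt_of_eq hpos ?_
          congr! 1
          ext
          simp only [mem_filter])
      have hy1 : f y = 1 := by
        revert hy0
        cases f y <;> decide
      refine ⟨y, mem_image_of_mem _ (mem_filter.2 ⟨mem_univ _, hy1⟩), ?_⟩
      rcases (mem_filter.1 hy).2 with rfl | hadj
      · exact Or.inl rfl
      · exact Or.inr ⟨⟨hv, hB⟩, AdjList.mem_natNbrs.2 ⟨hv, y.2, hadj⟩⟩
    · have ha : a = 1 := by
        rcases hneed with ⟨_, h⟩ | h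
        · exact absurd h hB
        · exact h
      have h1 : f ⟨v, hv⟩ = 1 := by
        have := hf.2 _ hB
        rw [ha] at this
        revert this
        cases f ⟨v, hv⟩ <;> decide
      exact ⟨v, mem_image.2 ⟨⟨v, hv⟩, mem_filter.2 ⟨mem_univ _, h1⟩, rfl⟩, Or.inl rfl⟩

-- All summands are nonnegative and a dominating vertex contributes `1`. A white vertex outside of
-- `S` has value `0`, which is allowed unless `a = 1`; in that case it had to dominate itself and so
-- lies in `S`.
open Classical in
theorem isMinusDomination_of_dominating {S : Finset ℕ}
    (hS : ∀ v, ¬ (netOf a B L hG).Pending S v) :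
    IsMinusDomination a G B (fun v => if (v : ℕ) ∈ S then 1 else 0) := by
  have key : ∀ v : Fin n, (netOf a B L hG).need v → ∃ y ∈ S, (netOf a B L hG).Sat y v := by
    intro v hv
    by_contra! h
    exact hS v ⟨v.2, hv, h⟩
  constructor
  · intro x hx
    obtain ⟨y, hy, hsat⟩ := key x (Or.inl ⟨x.2, hx⟩)
    unfold closedNbhdWeight
    have hnn : ∀ z : Fin n, (0 : ℤ) ≤ ((if (z : ℕ) ∈ S then 1 else 0 : SignType) : ℤ) := by
      intro z; split_ifs <;> decide
    obtain ⟨z, hz, hzy⟩ : ∃ z : Fin n, (z = x ∨ G.Adj x z) ∧ (z : ℕ) ∈ S := by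
      rcases hsat with rfl | ⟨-, h⟩
      · exact ⟨x, Or.inl rfl, hy⟩
      · obtain ⟨_, hyn, h⟩ := AdjList.mem_natNbrs.1 h
        exact ⟨⟨y, hyn⟩, Or.inr h, hy⟩
    refine sum_pos' (fun z _ => hnn z) ⟨z, ?_, ?_⟩
    · simpa only [mem_filter, mem_univ, true_and] using hz
    · simp only [if_pos hzy]
      decide
  · intro x hx
    dsimp only
    by_cases ha : a = 1
    · obtain ⟨y, hy, hsat⟩ := key x (Or.inr ha)
      rcases hsat with rfl | ⟨⟨_, h⟩, -⟩
      · rw [if_pos hy]; exact ha.le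
      · exact absurd h hx
    · have : a ≤ 0 := by
        revert ha
        cases a <;> decide
      split_ifs
      · exact this.trans (by decide)
      · exact this

open Classical in
theorem size_indicator_le {S : Finset ℕ} (hS : #S ≤ k) :
    size (fun v : Fin n => if (v : ℕ) ∈ S then (1 : SignType) else 0) ≤ k := by
  refine le_trans ?_ hS
  rw [size, ← Set.ncard_coe_finset S]
  refine Set.ncard_le_ncard_of_injOn Fin.val ?_ Fin.val_injective.injOn S.finite_toSet
  intro v hv
  by_contra h
  have h : (v : ℕ) ∉ S := h
  simp [h] at hv

/-! ### The adjacency lists in memory -/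

/-- The lists `nb v`, for `v < n`, are stored in array `1`, and array `0` holds their positions. -/
def Stored (n : ℕ) (nb : ℕ → List ℕ) (arr : ℕ → ℕ → ℕ) : Prop :=
  ∀ v < n, arr 0 (v + 1) - arr 0 v = (nb v).length ∧
    ∀ i (h : i < (nb v).length), arr 1 (arr 0 (v + 1) - ((nb v).length - i)) = (nb v)[i]

open Classical in
theorem sum_length_eq (L : AdjList G) (i : ℕ) (hi : i ≤ n) :
    ∑ u ∈ univ.filter (fun u : Fin n => u.val < i), (L.nbrs u).length =
      (((List.finRange n).take i).flatMap L.nbrs).length := by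
  induction i with
  | zero => simp
  | succ i ih =>
    have hf : univ.filter (fun u : Fin n => u.val < i + 1) =
        insert ⟨i, hi⟩ (univ.filter (fun u : Fin n => u.val < i)) := by
      ext u
      simp only [mem_filter, mem_univ, true_and, mem_insert, Fin.ext_iff]
      omega
    rw [hf, sum_insert (by simp), ih (by omega), List.take_succ_eq_append_getElem (by simpa),
      List.flatMap_append, List.length_append]
    exact (add_comm _ _).trans (by simp)

theorem stored_initState (L : AdjList G) :
    Stored n L.natNbrs (initState d k L B).arr := by
  intro v hv
  have e0 : ∀ i ≤ n, (initState d k L B).arr 0 i =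
      (((List.finRange n).take i).flatMap L.nbrs).length := by
    intro i hi
    rw [← sum_length_eq L i hi]
    simp [initState, hi]
  have e1 : ∀ i, (initState d k L B).arr 1 i =
      (((List.finRange n).flatMap L.nbrs).map Fin.val).getD i 0 := by
    intro i; simp [initState]
  have hsucc : (((List.finRange n).take (v + 1)).flatMap L.nbrs) =
      ((List.finRange n).take v).flatMap L.nbrs ++ L.nbrs ⟨v, hv⟩ := by
    rw [List.take_succ_eq_append_getElem (by simpa), List.flatMap_append]
    simp
  have hnb : L.natNbrs v = (L.nbrs ⟨v, hv⟩).map Fin.val := dif_pos hv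
  rw [e0 _ hv, e0 _ hv.le, hsucc, List.length_append]
  simp only [hnb, List.length_map, List.getElem_map]
  refine ⟨by omega, fun i hi => ?_⟩
  -- The list of `v` is a block in the concatenation; the block before it has the length stored in
  -- cell `v` of array `0`.
  have hall : (List.finRange n).flatMap L.nbrs =
      ((List.finRange n).take v).flatMap L.nbrs ++ (L.nbrs ⟨v, hv⟩ ++
        ((List.finRange n).drop (v + 1)).flatMap L.nbrs) := by
    rw [← List.append_assoc, ← hsucc, ← List.flatMap_append, List.take_append_drop]
  rw [e1, hall, List.map_append, List.map_append, List.getD_append_right _ _ _ _ (by simp; omega),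
    List.getD_append _ _ _ _ (by simp; omega)]
  rw [List.length_map, show ∀ a b c : ℕ, c < b → a + b - (b - c) - a = c by omega]
  · rw [List.getD_eq_getElem _ _ (by simpa), List.getElem_map]
  · exact hi

end Bridge

/-! ### Weakest preconditions -/

/-- Started in `s`, the program `P` halts in some state after some number of steps for which
`Q` holds. -/
def wp (w : ℕ) (P : Prog) (s : State) (Q : State → ℕ → Prop) : Prop :=
  ∃ s' t, Exec w P s s' t ∧ Q s' t

section Rules

variable {w : ℕ} {s : State} {Q : State → ℕ → Prop}

theorem wp_skip : wp w .skip s Q ↔ Q s 1 :=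
  ⟨fun ⟨_, _, h, hq⟩ => by cases h; exact hq, fun h => ⟨_, _, .skip s, h⟩⟩

theorem wp_const {r c : ℕ} : wp w (.const r c) s Q ↔ c ≤ w ∧ Q (s.setReg r c) 1 :=
  ⟨fun ⟨_, _, h, hq⟩ => by cases h with | const _ _ _ h => exact ⟨h, hq⟩,
    fun h => ⟨_, _, .const s r c h.1, h.2⟩⟩

theorem wp_copy {r p : ℕ} : wp w (.copy r p) s Q ↔ Q (s.setReg r (s.reg p)) 1 :=
  ⟨fun ⟨_, _, h, hq⟩ => by cases h; exact hq, fun h => ⟨_, _, .copy s r p, h⟩⟩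

theorem wp_add {r p q : ℕ} :
    wp w (.add r p q) s Q ↔ s.reg p + s.reg q ≤ w ∧ Q (s.setReg r (s.reg p + s.reg q)) 1 :=
  ⟨fun ⟨_, _, h, hq⟩ => by cases h with | add _ _ _ _ h => exact ⟨h, hq⟩,
    fun h => ⟨_, _, .add s r p q h.1, h.2⟩⟩

theorem wp_sub {r p q : ℕ} :
    wp w (.sub r p q) s Q ↔ Q (s.setReg r (s.reg p - s.reg q)) 1 :=
  ⟨fun ⟨_, _, h, hq⟩ => by cases h; exact hq, fun h => ⟨_, _, .sub s r p q, h⟩⟩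

theorem wp_load {r A p : ℕ} :
    wp w (.load r A p) s Q ↔ Q (s.setReg r (s.arr A (s.reg p))) 1 :=
  ⟨fun ⟨_, _, h, hq⟩ => by cases h; exact hq, fun h => ⟨_, _, .load s r A p, h⟩⟩

theorem wp_store {A p q : ℕ} :
    wp w (.store A p q) s Q ↔ Q (s.setArr A (s.reg p) (s.reg q)) 1 :=
  ⟨fun ⟨_, _, h, hq⟩ => by cases h; exact hq, fun h => ⟨_, _, .store s A p q, h⟩⟩

theorem wp_seq {P P' : Prog} :
    wp w (.seq P P') s Q ↔ wp w P s fun s₁ t₁ => wp w P' s₁ fun s₂ t₂ => Q s₂ (t₁ + t₂) :=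
  ⟨fun ⟨_, _, h, hq⟩ => by
      cases h with | seq h₁ h₂ => exact ⟨_, _, h₁, _, _, h₂, hq⟩,
    fun ⟨_, _, h₁, _, _, h₂, hq⟩ => ⟨_, _, .seq h₁ h₂, hq⟩⟩

theorem wp_branch {p q : ℕ} {P P' : Prog} :
    wp w (.branch p q P P') s Q ↔
      (s.reg p < s.reg q → wp w P s fun s' t => Q s' (t + 1)) ∧
      (¬ s.reg p < s.reg q → wp w P' s fun s' t => Q s' (t + 1)) := by
  constructor
  · rintro ⟨_, _, h, hq⟩
    cases h with
    | branch_true hc h => exact ⟨fun _ => ⟨_, _, h, hq⟩, fun hn => absurd hc hn⟩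
    | branch_false hc h => exact ⟨fun hn => absurd hn hc, fun _ => ⟨_, _, h, hq⟩⟩
  · rintro ⟨h₁, h₂⟩
    by_cases hc : s.reg p < s.reg q
    · obtain ⟨_, _, h, hq⟩ := h₁ hc
      exact ⟨_, _, .branch_true hc h, hq⟩
    · obtain ⟨_, _, h, hq⟩ := h₂ hc
      exact ⟨_, _, .branch_false hc h, hq⟩

theorem wp.mono {P : Prog} {Q' : State → ℕ → Prop} (h : wp w P s Q')
    (hQ : ∀ s' t, Q' s' t → Q s' t) : wp w P s Q := by
  obtain ⟨s', t, h, hq⟩ := h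
  exact ⟨s', t, h, hQ _ _ hq⟩

/-- A loop with an invariant and a variant. -/
theorem wp_while {p q : ℕ} {P : Prog} (I : State → Prop) (μ : State → ℕ) (C : ℕ)
    (hstep : ∀ s, I s → s.reg p < s.reg q →
      wp w P s fun s' t => t ≤ C ∧ I s' ∧ μ s' < μ s) (m : ℕ) :
    ∀ s, I s → μ s ≤ m → wp w (.loop p q P) s fun s' t =>
      t ≤ m * (C + 1) + 1 ∧ I s' ∧ ¬ s'.reg p < s'.reg q := by
  induction m with
  | zero =>
    intro s hI hm
    by_cases hc : s.reg p < s.reg q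
    · obtain ⟨s', t, -, -, -, h⟩ := hstep s hI hc
      omega
    · exact ⟨s, 1, .loop_false hc, by omega, hI, hc⟩
  | succ m ih =>
    intro s hI hm
    by_cases hc : s.reg p < s.reg q
    · obtain ⟨s₁, t₁, h₁, ht₁, hI₁, hμ⟩ := hstep s hI hc
      obtain ⟨s₂, t₂, h₂, ht₂, hQ⟩ := ih s₁ hI₁ (by omega)
      refine ⟨s₂, _, .loop_true hc h₁ h₂, ?_, hQ⟩
      rw [Nat.succ_mul]
      omega
    · exact ⟨s, 1, .loop_false hc, by omega, hI, hc⟩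

/-- A loop with a known number of iterations, whose costs may differ. -/
theorem wp_for_sum {p q : ℕ} {P : Prog} (m : ℕ) (I : ℕ → State → Prop) (C : ℕ → ℕ)
    (hstep : ∀ j < m, ∀ s, I j s →
      s.reg p < s.reg q ∧ wp w P s fun s' t => t ≤ C j ∧ I (j + 1) s')
    (hend : ∀ s, I m s → ¬ s.reg p < s.reg q) {s : State} (h0 : I 0 s) :
    wp w (.loop p q P) s fun s' t => t ≤ ∑ j ∈ range m, (C j + 1) + 1 ∧ I m s' := by
  induction m generalizing I C s with
  | zero => exact ⟨s, 1, .loop_false (hend s h0), by simp, h0⟩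
  | succ m ih =>
    obtain ⟨hc, s₁, t₁, h₁, ht₁, hI₁⟩ := hstep 0 (by omega) s h0
    obtain ⟨s₂, t₂, h₂, ht₂, hQ⟩ := ih (fun j => I (j + 1)) (fun j => C (j + 1))
      (fun j hj s hs => hstep (j + 1) (by omega) s hs) hend hI₁
    refine ⟨s₂, _, .loop_true hc h₁ h₂, ?_, hQ⟩
    rw [sum_range_succ']
    omega

/-- A loop with a known number of iterations. -/
theorem wp_for {p q : ℕ} {P : Prog} (m : ℕ) (I : ℕ → State → Prop) (C : ℕ)
    (hstep : ∀ j < m, ∀ s, I j s →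
      s.reg p < s.reg q ∧ wp w P s fun s' t => t ≤ C ∧ I (j + 1) s')
    (hend : ∀ s, I m s → ¬ s.reg p < s.reg q) {s : State} (h0 : I 0 s) :
    wp w (.loop p q P) s fun s' t => t ≤ m * (C + 1) + 1 ∧ I m s' := by
  simpa using wp_for_sum m I (fun _ => C) hstep hend h0

end Rules

/-! ### Reading after writing, and frame conditions -/

theorem reg_setReg (s : State) (r v r' : ℕ) :
    (s.setReg r v).reg r' = if r' = r then v else s.reg r' := by
  simp [State.setReg, Function.update_apply]

theorem arr_setReg (s : State) (r v : ℕ) : (s.setReg r v).arr = s.arr := rfl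

theorem reg_setArr (s : State) (A i v : ℕ) : (s.setArr A i v).reg = s.reg := rfl

theorem arr_setArr (s : State) (A i v B : ℕ) :
    (s.setArr A i v).arr B = if B = A then Function.update (s.arr A) i v else s.arr B := by
  simp [State.setArr, Function.update_apply]

/-- The registers below `K` and the arrays outside of `As` have the same contents in `s` and
`s'`. -/
def Keep (K : ℕ) (As : Set ℕ) (s s' : State) : Prop :=
  (∀ r < K, s'.reg r = s.reg r) ∧ ∀ A ∉ As, s'.arr A = s.arr A

section Keep

variable {K : ℕ} {As : Set ℕ} {s s' s'' : State}

theorem Keep.refl : Keep K As s s := ⟨fun _ _ => rfl, fun _ _ => rfl⟩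

theorem Keep.trans (h : Keep K As s s') (h' : Keep K As s' s'') : Keep K As s s'' :=
  ⟨fun r hr => (h'.1 r hr).trans (h.1 r hr), fun A hA => (h'.2 A hA).trans (h.2 A hA)⟩

theorem Keep.weaken {K' : ℕ} {As' : Set ℕ} (h : Keep K As s s') (hK : K' ≤ K) (hA : As ⊆ As') :
    Keep K' As' s s' :=
  ⟨fun r hr => h.1 r (by omega), fun A hn => h.2 A fun h => hn (hA h)⟩

theorem keep_setReg {r v : ℕ} (hr : K ≤ r) : Keep K As s (s'.setReg r v) ↔ Keep K As s s' := by
  unfold Keep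
  rw [arr_setReg]
  refine and_congr_left fun _ => forall₂_congr fun r' hr' => ?_
  rw [reg_setReg, if_neg (by omega)]

theorem keep_setArr {A i v : ℕ} (hA : A ∈ As) :
    Keep K As s (s'.setArr A i v) ↔ Keep K As s s' := by
  unfold Keep
  rw [reg_setArr]
  refine and_congr_right fun _ => forall₂_congr fun B hB => ?_
  rw [arr_setArr, if_neg (by rintro rfl; exact hB hA)]

end Keep

/-! ### Subroutines -/

/-- Runs through the adjacency list of the vertex in register `r`. The body finds the neighbor in
register `26`. -/
def scanNbrs (r : ℕ) (body : Prog) : Prog :=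
  .seq (.load 24 0 r) <| .seq (.add 25 r 3) <| .seq (.load 25 0 25) <| .seq (.sub 24 25 24) <|
  .loop 4 24 <| .seq (.sub 26 25 24) <| .seq (.load 26 1 26) <| .seq body (.sub 24 24 3)

/-- Since the list has no repetitions, the body meets each entry with its original content, so its
effect is a function `g` of the neighbor alone. The body must preserve the registers below `27`, and
`2 ≤ A` protects the stored graph. -/
theorem wp_scanNbrs {w n u r A C : ℕ} {nb : ℕ → List ℕ} {body : Prog} {s : State} (g : ℕ → ℕ)
    (h3 : s.reg 3 = 1) (h4 : s.reg 4 = 0) (hs : Stored n nb s.arr) (hr : s.reg r = u)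
    (hr' : r < 24) (hu : u < n) (hw : n ≤ w) (hA : 2 ≤ A) (hnd : (nb u).Nodup)
    (hlen : (nb u).length ≤ n)
    (hbody : ∀ s' x, x ∈ nb u → Keep 24 {A} s s' → s'.reg 26 = x → s'.arr A x = s.arr A x →
      wp w body s' fun s'' t => t ≤ C ∧ Keep 27 {A} s' s'' ∧
        s''.arr A = Function.update (s'.arr A) x (g x)) :
    wp w (scanNbrs r body) s fun s' t => t ≤ n * (C + 4) + 5 ∧ Keep 24 {A} s s' ∧
      ∀ x, s'.arr A x = if x ∈ nb u then g x else s.arr A x := by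
  obtain ⟨hl, hnth⟩ := hs u hu
  have hn24 : r ≠ 24 := by omega
  simp only [scanNbrs, wp_seq, wp_load, wp_add, wp_sub, reg_setReg, arr_setReg, h3, hr, hn24]
  simp
  refine ⟨by omega, ?_⟩
  -- Register `24` counts the neighbors that remain, and register `25` holds the end of the list;
  -- their difference is the current position.
  refine (wp_for (nb u).length (fun j s' => Keep 24 {A} s s' ∧ s'.reg 24 = (nb u).length - j ∧
    s'.reg 25 = s.arr 0 (u + 1) ∧
    ∀ x, s'.arr A x = if x ∈ (nb u).take j then g x else s.arr A x) (C + 3) ?_ ?_ ?_).mono ?_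
  · rintro j hj s' ⟨hk, h24, h25, hA'⟩
    have h3' : s'.reg 3 = 1 := (hk.1 3 (by omega)).trans h3
    have h4' : s'.reg 4 = 0 := (hk.1 4 (by omega)).trans h4
    have h1' : s'.arr 1 = s.arr 1 := hk.2 1 (by simp; omega)
    have hx : (nb u)[j] ∉ (nb u).take j := by
      intro hm
      obtain ⟨i, hi, he⟩ := List.mem_take_iff_getElem.1 hm
      have := (List.Nodup.getElem_inj_iff hnd).1 he
      omega
    refine ⟨by omega, ?_⟩
    simp only [wp_seq, wp_load, wp_sub, reg_setReg, arr_setReg, h24, h25, h1']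
    simp
    refine (hbody _ (nb u)[j] (List.getElem_mem hj) ?_ (by simp [reg_setReg, hnth j hj])
      ?_).mono ?_
    · rw [keep_setReg (by omega), keep_setReg (by omega)]
      exact hk
    · rw [arr_setReg, arr_setReg, hA', if_neg hx]
    · rintro s'' t ⟨ht, hk', hA''⟩
      have h3'' : s''.reg 3 = 1 := (hk'.1 3 (by omega)).trans (by simp [reg_setReg, h3'])
      have h24'' : s''.reg 24 = (nb u).length - j :=
        (hk'.1 24 (by omega)).trans (by simp [reg_setReg, h24])
      have h25'' : s''.reg 25 = s.arr 0 (u + 1) :=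
        (hk'.1 25 (by omega)).trans (by simp [reg_setReg, h25])
      refine ⟨by omega, ?_, by simp [h24'', h3'']; omega, by simp [h25''], ?_⟩
      · rw [keep_setReg le_rfl]
        refine hk.trans (Keep.trans ?_ (hk'.weaken (by omega) subset_rfl))
        rw [keep_setReg (by omega), keep_setReg (by omega)]
        exact Keep.refl
      · intro x
        have hm : x ∈ (nb u).take (j + 1) ↔ x ∈ (nb u).take j ∨ x = (nb u)[j] := by
          rw [List.take_succ_eq_append_getElem hj, List.mem_append, List.mem_singleton]
        rw [hA'', arr_setReg, arr_setReg, Function.update_apply, hA']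
        simp only [hm]
        by_cases hxj : x = (nb u)[j]
        · rw [if_pos hxj, if_pos (Or.inr hxj), hxj]
        · simp only [hxj, if_false, or_false]
  · rintro s' ⟨hk, h24, -⟩
    omega
  · refine ⟨?_, ?_, ?_, ?_⟩
    · simp only [keep_setReg, Nat.le_refl, Nat.reduceLeDiff]
      exact Keep.refl
    · simp [reg_setReg]
      omega
    · simp [reg_setReg]
    · simp [arr_setReg]
  · rintro s' t ⟨ht, hk, -, -, h⟩
    refine ⟨?_, hk, fun x => by rw [h, List.take_length]⟩
    have := Nat.mul_le_mul_right (C + 4) hlen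
    have e : C + 3 + 1 = C + 4 := rfl
    rw [e] at ht
    omega

/-- The program's constants and the input, for numbers of `2 ^ M` and `2 ^ (M * (2 * k))`. -/
structure Base {n d : ℕ} (N : Net n d) (k M : ℕ) (s : State) : Prop where
  r0 : s.reg 0 = n
  r1 : s.reg 1 = k
  r3 : s.reg 3 = 1
  r4 : s.reg 4 = 0
  r5 : s.reg 5 = 2
  r6 : s.reg 6 = 2 ^ M
  r7 : s.reg 7 = 2 ^ M - 1
  r8 : s.reg 8 = 2 ^ (M * (2 * k))
  stored : Stored n N.nb s.arr
  black : ∀ v < n, (N.black v → s.arr 2 v = 1) ∧ (¬ N.black v → s.arr 2 v = 0)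

/-! ### Masks and division on the machine -/

section Base

variable {n d : ℕ} {N : Net n d} {k M w : ℕ} {s : State}

theorem Base.of_keep {K : ℕ} {As : Set ℕ} {s' : State} (h : Base N k M s) (hk : Keep K As s s')
    (hK : 9 ≤ K) (hA : As ⊆ {3, 4, 5}) : Base N k M s' := by
  have ha : ∀ A < 3, s'.arr A = s.arr A := fun A hA' => hk.2 A fun hm => by
    have := hA hm
    simp at this
    omega
  constructor
  · rw [hk.1 0 (by omega), h.r0]
  · rw [hk.1 1 (by omega), h.r1]
  · rw [hk.1 3 (by omega), h.r3]
  · rw [hk.1 4 (by omega), h.r4]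
  · rw [hk.1 5 (by omega), h.r5]
  · rw [hk.1 6 (by omega), h.r6]
  · rw [hk.1 7 (by omega), h.r7]
  · rw [hk.1 8 (by omega), h.r8]
  · have := h.stored
    unfold Stored at this ⊢
    rw [ha 0 (by omega), ha 1 (by omega)]
    exact this
  · rw [ha 2 (by omega)]
    exact h.black

theorem Net.length_nb_le (N : Net n d) (v : ℕ) : (N.nb v).length ≤ n := by
  have h : (N.nb v).toFinset ⊆ range n := fun u hu =>
    mem_range.2 (N.lt v u (List.mem_toFinset.1 hu))
  have := card_le_card h
  rwa [List.toFinset_card_of_nodup (N.nodup v), card_range] at this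

/-- Adds register `17` to the entries of array `5` of all vertices that satisfy the demand of the
vertex in register `16`. -/
def addMask : Prog :=
  .seq (.load 18 5 16) <| .seq (.add 18 18 17) <| .seq (.store 5 16 18) <|
  .seq (.load 18 2 16) <|
  .branch 4 18
    (scanNbrs 16 (.seq (.load 27 5 26) <| .seq (.add 27 27 17) (.store 5 26 27))) .skip

-- By symmetry the vertices that satisfy the demand of `u` are `u` and, if `u` is black, the members
-- of its own list. Hence one list suffices to update all masks.
open Classical in
theorem wp_addMask {u p : ℕ} (hB : Base N k M s) (h16 : s.reg 16 = u) (h17 : s.reg 17 = p)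
    (hu : u < n) (hn : n ≤ w) (hw : ∀ v < n, s.arr 5 v + p ≤ w) :
    wp w addMask s fun s' t => t ≤ n * 7 + 10 ∧ Keep 18 {5} s s' ∧
      ∀ v < n, s'.arr 5 v = s.arr 5 v + if N.Sat v u then p else 0 := by
  have hB18 := hB.black u hu
  simp only [addMask, wp_seq, wp_load, wp_add, wp_store, wp_branch, wp_skip, reg_setReg,
    arr_setReg, arr_setArr, reg_setArr, h16, h17]
  simp
  refine ⟨hw u hu, fun hpos => ?_, fun hz => ?_⟩
  · have hblack : N.black u := by
      by_contra hb
      rw [hB18.2 hb] at hpos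
      omega
    set s₁ := (((s.setReg 18 (s.arr 5 u)).setReg 18 (s.arr 5 u + p)).setArr 5 u
      (s.arr 5 u + p)).setReg 18 (s.arr 2 u) with hs₁
    have hk₁ : Keep 18 {5} s s₁ := by
      rw [hs₁, keep_setReg le_rfl, keep_setArr (by simp), keep_setReg le_rfl, keep_setReg le_rfl]
      exact Keep.refl
    have hB₁ := hB.of_keep hk₁ (by omega) (by simp)
    have harr : ∀ v, s₁.arr 5 v = if v = u then s.arr 5 u + p else s.arr 5 v := by
      intro v
      rw [hs₁, arr_setReg, arr_setArr, if_pos rfl, Function.update_apply]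
      rfl
    refine (wp_scanNbrs (n := n) (u := u) (A := 5) (C := 3) (nb := N.nb)
      (fun x => s.arr 5 x + p) hB₁.r3 hB₁.r4 hB₁.stored ((hk₁.1 16 (by omega)).trans h16)
      (by omega) hu hn (by omega) (N.nodup u) (N.length_nb_le u) ?_).mono ?_
    · intro s' x hx hk' h26 hA
      -- The entry of `u` was increased before the scan; without loops the scan does not meet it
      -- again.
      have hxu : x ≠ u := by rintro rfl; exact N.irrefl x hx
      rw [harr, if_neg hxu] at hA
      have h17' : s'.reg 17 = p :=
        (hk'.1 17 (by omega)).trans ((hk₁.1 17 (by omega)).trans h17)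
      simp only [wp_seq, wp_load, wp_add, wp_store, reg_setReg, arr_setReg, arr_setArr, h26,
        h17', hA]
      simp
      refine ⟨hw x (N.lt u x hx), ?_⟩
      rw [keep_setArr (by simp), keep_setReg le_rfl, keep_setReg le_rfl]
      exact Keep.refl
    · rintro s' t ⟨ht, hk', hA⟩
      refine ⟨by omega, hk₁.trans (hk'.weaken (by omega) subset_rfl), ?_⟩
      intro v hv
      rw [hA, harr]
      have hsat : N.Sat v u ↔ v = u ∨ v ∈ N.nb u := by simp [Net.Sat, hblack]
      by_cases hvu : v = u
      · subst hvu
        simp [hsat, N.irrefl]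
      · simp only [hsat, hvu, false_or, if_false]
        split_ifs <;> simp
  · have hwhite : ¬ N.black u := fun hb => by
      rw [hB18.1 hb, hB.r4] at hz
      omega
    refine ⟨?_, ?_⟩
    · rw [keep_setReg le_rfl, keep_setArr (by simp), keep_setReg le_rfl, keep_setReg le_rfl]
      exact Keep.refl
    · intro v hv
      have hsat : N.Sat v u ↔ v = u := by simp [Net.Sat, hwhite]
      simp only [hsat, Function.update_apply]
      split_ifs with h
      · rw [h]
      · rfl

/-- Computes the masks in array `5`. -/
def computeMasks : Prog :=
  .seq (.const 16 0) <|
  .seq (.loop 16 0 (.seq (.store 5 16 4) (.add 16 16 3))) <|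
  .seq (.const 17 1) <| .seq (.const 16 0) <|
  .loop 16 0 <| .seq (.load 18 4 16) <|
  .seq (.branch 4 18 (.branch 17 6 (.seq addMask (.add 17 17 17)) .skip) .skip) (.add 16 16 3)

/-- Array `4` holds the pending vertices. -/
def Net.Shows (N : Net n d) (S : Finset ℕ) (s : State) : Prop :=
  ∀ v < n, (N.Pending S v → s.arr 4 v = 1) ∧ (¬ N.Pending S v → s.arr 4 v = 0)

-- Register `17` holds the bit of the next pending vertex and stops doubling at `2 ^ M`. So at most
-- `M` rounds read an adjacency list; the sum of unequal costs makes use of this and yields a bound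
-- linear in `n`.
open Classical in
theorem wp_computeMasks {S : Finset ℕ} (hB : Base N k M s) (hS : N.Shows S s)
    (hw : n + 2 * 2 ^ M ≤ w) :
    wp w computeMasks s fun s' t => t ≤ n * 9 + M * (n * 7 + 11) + 10 ∧ Keep 16 {5} s s' ∧
      ∀ v < n, s'.arr 5 v = N.mask M S v := by
  have hM : 0 < 2 ^ M := by positivity
  simp only [computeMasks, wp_seq (P := .const _ _), wp_const]
  refine ⟨by omega, ?_⟩
  rw [wp_seq]
  refine (wp_for n (fun j s' => Keep 16 {5} s s' ∧ s'.reg 16 = j ∧ ∀ v < j, s'.arr 5 v = 0) 2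
    ?_ ?_ ?_).mono ?_
  · rintro j hj s' ⟨hk, h16, h5⟩
    have hB' := hB.of_keep hk (by omega) (by simp)
    refine ⟨by rw [h16, hB'.r0]; exact hj, ?_⟩
    simp only [wp_seq, wp_add, wp_store, reg_setReg, arr_setReg, arr_setArr, reg_setArr, h16,
      hB'.r3, hB'.r4]
    simp
    refine ⟨by omega, ?_, ?_⟩
    · rw [keep_setReg le_rfl, keep_setArr (by simp)]
      exact hk
    · intro v hv
      rw [Function.update_apply]
      split_ifs with h
      · rfl
      · exact h5 v (by omega)
  · rintro s' ⟨hk, h16, -⟩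
    have hB' := hB.of_keep hk (by omega) (by simp)
    rw [h16, hB'.r0]
    omega
  · refine ⟨?_, by simp [reg_setReg], by simp⟩
    rw [keep_setReg le_rfl]
    exact Keep.refl
  · rintro s₁ t₁ ⟨ht₁, hk₁, -, h5⟩
    simp only [wp_seq (P := .const _ _), wp_const]
    refine ⟨by omega, by omega, ?_⟩
    refine (wp_for_sum n (fun j s' => Keep 16 {5} s s' ∧ s'.reg 16 = j ∧
      s'.reg 17 = 2 ^ min (N.rank S j) M ∧ ∀ v < n, s'.arr 5 v = N.maskUpTo M S j v)
      (fun j => 5 + if N.Pending S j ∧ N.rank S j < M then n * 7 + 11 else 0) ?_ ?_ ?_).mono ?_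
    · rintro j hj s' ⟨hk, h16, h17, h5⟩
      have hB' := hB.of_keep hk (by omega) (by simp)
      have h4 : s'.arr 4 = s.arr 4 := hk.2 4 (by simp)
      refine ⟨by rw [h16, hB'.r0]; exact hj, ?_⟩
      have hpow : (2 ^ min (N.rank S j) M < 2 ^ M) ↔ N.rank S j < M := by
        rw [Nat.pow_lt_pow_iff_right (by omega)]; omega
      simp only [wp_seq (P' := .add 16 16 3), wp_seq (P := .load _ _ _), wp_load, wp_branch,
        reg_setReg, arr_setReg, h16, h17, h4, wp_skip, wp_add, hB'.r4, hB'.r6, hB'.r3]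
      simp
      refine ⟨fun hpos => ⟨fun hlt => ?_, fun hge => ?_⟩, fun hz => ?_⟩
      · have hpend : N.Pending S j := by
          by_contra h
          have := (hS j hj).2 h
          omega
        have hlt' := hpow.1 hlt
        rw [wp_seq]
        have hk' : Keep 16 {5} s (s'.setReg 18 (s.arr 4 j)) := by
          rw [keep_setReg (by omega)]; exact hk
        refine (wp_addMask (u := j) (p := 2 ^ min (N.rank S j) M)
          (hB.of_keep hk' (by omega) (by simp)) (by simp [reg_setReg, h16])
          (by simp [reg_setReg, h17]) hj (by omega) ?_).mono ?_
        · intro v hv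
          have := N.maskUpTo_lt M S j v
          rw [arr_setReg, h5 v hv]
          omega
        · rintro s₂ t₂ ⟨ht₂, hk₂, h5₂⟩
          have e16 : s₂.reg 16 = j := by
            rw [hk₂.1 16 (by omega), reg_setReg, if_neg (by omega), h16]
          have e17 : s₂.reg 17 = 2 ^ min (N.rank S j) M := by
            rw [hk₂.1 17 (by omega), reg_setReg, if_neg (by omega), h17]
          have e3 : s₂.reg 3 = 1 := by
            rw [hk₂.1 3 (by omega), reg_setReg, if_neg (by omega), hB'.r3]
          have hrank : min (N.rank S (j + 1)) M = min (N.rank S j) M + 1 := by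
            rw [N.rank_succ, if_pos hpend]
            omega
          simp only [wp_add, reg_setReg, e16, e17, e3]
          simp
          refine ⟨by omega, by omega, ?_, ?_, ?_, ?_⟩
          · rw [if_pos ⟨hpend, hlt'⟩]
            omega
          · rw [keep_setReg le_rfl, keep_setReg (by omega)]
            exact hk'.trans (hk₂.weaken (by omega) subset_rfl)
          · rw [hrank, pow_succ]
            omega
          · intro v hv
            rw [arr_setReg, h5₂ v hv, arr_setReg, h5 v hv, Net.maskUpTo,
              Net.maskUpTo, sum_range_succ, min_eq_left hlt'.le]
            simp only [hpend, hlt', true_and]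
      · have hge' : ¬ N.rank S j < M := fun h => absurd (hpow.2 h) (by omega)
        refine ⟨by omega, ?_, ?_, ?_⟩
        · rw [keep_setReg le_rfl, keep_setReg (by omega)]
          exact hk
        · have := N.rank_mono S (Nat.le_succ j)
          simp only [Nat.succ_eq_add_one] at this
          omega
        · intro v hv
          rw [h5 v hv, Net.maskUpTo, Net.maskUpTo, sum_range_succ,
            if_neg (by tauto), Nat.add_zero]
      · have hnp : ¬ N.Pending S j := fun h => by
          have := (hS j hj).1 h
          omega
        refine ⟨by omega, by omega, ?_, ?_, ?_⟩
        · rw [keep_setReg le_rfl, keep_setReg (by omega)]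
          exact hk
        · rw [N.rank_succ, if_neg hnp, Nat.add_zero]
        · intro v hv
          rw [h5 v hv, Net.maskUpTo, Net.maskUpTo, sum_range_succ,
            if_neg (by tauto), Nat.add_zero]
    · rintro s' ⟨hk, h16, -⟩
      have hB' := hB.of_keep hk (by omega) (by simp)
      rw [h16, hB'.r0]
      omega
    · refine ⟨?_, by simp [reg_setReg], ?_, ?_⟩
      · rw [keep_setReg le_rfl, keep_setReg (by omega)]
        exact hk₁
      · simp [reg_setReg, Net.rank]
      · intro v hv
        rw [arr_setReg, arr_setReg, h5 v hv, Net.maskUpTo, range_zero, sum_empty]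
    · rintro s' t ⟨ht, hk, -, -, h5⟩
      refine ⟨?_, hk, h5⟩
      have hsum : ∑ j ∈ range n, (5 + (if N.Pending S j ∧ N.rank S j < M then n * 7 + 11 else 0)
          + 1) = n * 6 + #(N.firstUpTo M S n) * (n * 7 + 11) := by
        rw [sum_congr rfl (fun j _ => (by omega : 5 + (if N.Pending S j ∧ N.rank S j < M then
          n * 7 + 11 else 0) + 1 = 6 + (if N.Pending S j ∧ N.rank S j < M then
          n * 7 + 11 else 0))), sum_add_distrib, ← sum_filter, sum_const, sum_const, card_range,
          smul_eq_mul, smul_eq_mul, Net.firstUpTo]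
      have hle : #(N.firstUpTo M S n) * (n * 7 + 11) ≤ M * (n * 7 + 11) :=
        Nat.mul_le_mul_right _ ((N.card_firstUpTo M S n).trans_le (min_le_right _ _))
      omega

/-- Divides register `12` by `2 ^ M`, with the remainder in register `18`. -/
def divMod : Prog :=
  .seq (.copy 18 12) <| .seq (.const 19 0) <|
  .seq (.loop 7 18 (.seq (.sub 18 18 6) (.add 19 19 3))) (.copy 12 19)

/-- Repeated subtraction. Besides the frame below `12`, the other registers below `18` are preserved
because the first digit, in register `13`, has to survive the second division. -/
theorem wp_divMod {x : ℕ} (hB : Base N k M s) (h12 : s.reg 12 = x) (hw : x ≤ w) :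
    wp w divMod s fun s' t => t ≤ x * 3 + 4 ∧ Keep 12 ∅ s s' ∧
      (∀ r < 18, r ≠ 12 → s'.reg r = s.reg r) ∧
      s'.reg 18 = x % 2 ^ M ∧ s'.reg 12 = x / 2 ^ M := by
  have hM : 0 < 2 ^ M := by positivity
  simp only [divMod, wp_seq (P := .copy _ _), wp_seq (P := .const _ _), wp_copy, wp_const]
  refine ⟨by omega, ?_⟩
  rw [wp_seq]
  have hdm := Nat.div_add_mod x (2 ^ M)
  have hdle : x / 2 ^ M ≤ x := Nat.div_le_self _ _
  refine (wp_for (x / 2 ^ M) (fun j s' => Keep 18 ∅ s s' ∧ s'.reg 18 = x - 2 ^ M * j ∧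
    s'.reg 19 = j) 2 ?_ ?_ ?_).mono ?_
  · rintro j hj s' ⟨hk, h18, h19⟩
    have hB' := hB.of_keep hk (by omega) (by simp)
    have := Nat.mul_le_mul_left (2 ^ M) (Nat.succ_le_of_lt hj)
    rw [Nat.mul_succ] at this
    -- Comparison is strict, so `2 ^ M ≤ r` is tested as `2 ^ M - 1 < r`.
    refine ⟨by rw [hB'.r7, h18]; omega, ?_⟩
    simp only [wp_seq, wp_sub, wp_add, reg_setReg, h18, h19, hB'.r3, hB'.r6]
    simp
    refine ⟨by omega, ?_, ?_⟩
    · rw [keep_setReg (by omega), keep_setReg (by omega)]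
      exact hk
    · rw [Nat.mul_succ]
      omega
  · rintro s' ⟨hk, h18, h19⟩
    have hB' := hB.of_keep hk (by omega) (by simp)
    have := Nat.mod_lt x hM
    rw [hB'.r7, h18]
    omega
  · refine ⟨?_, by simp [reg_setReg, h12], by simp [reg_setReg]⟩
    rw [keep_setReg (by omega), keep_setReg (by omega)]
    exact Keep.refl
  · rintro s' t ⟨ht, hk, h18, h19⟩
    rw [wp_copy]
    refine ⟨by omega, ?_, ?_, ?_, ?_⟩
    · rw [keep_setReg le_rfl]
      exact hk.weaken (by omega) subset_rfl
    · intro r hr hne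
      rw [reg_setReg, if_neg hne, hk.1 r hr]
    · rw [reg_setReg, if_neg (by omega), h18]
      omega
    · rw [reg_setReg, if_pos rfl, h19]

end Base

/-- Looks for the vertex whose mask is in register `13` and whose number among these is in
register `14`. -/
def scanMasks : Prog :=
  .seq (.const 16 0) <| .seq (.copy 15 0) <|
  .loop 16 0 <| .seq (.load 18 5 16) <|
  .seq (.branch 18 13 .skip <| .branch 13 18 .skip <|
    .branch 4 14 (.seq (.copy 15 16) (.sub 14 14 3)) .skip) (.add 16 16 3)

/-- Chooses the vertex in register `15`. -/
def choose : Prog :=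
  .seq (.store 3 15 5) <| .seq (.store 4 15 4) <|
  scanNbrs 15 (.seq (.load 27 4 26) <| .seq (.load 28 2 26) <| .seq (.sub 27 27 28)
    (.store 4 26 27))

/-- One step of the search. -/
def searchStep : Prog :=
  .seq computeMasks <| .seq divMod <| .seq (.copy 13 18) <| .seq divMod <|
  .seq (.copy 14 18) <| .seq scanMasks <| .branch 15 0 choose .skip

/-- Array `3` holds `2` for the vertices of `S` and `1` for the others. -/
def Marks (n : ℕ) (S : Finset ℕ) (s : State) : Prop :=
  ∀ v < n, s.arr 3 v = if v ∈ S then 2 else 1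

/-! ### One step of the search on the machine -/

section Step

variable {n d : ℕ} {N : Net n d} {k M w : ℕ} {s : State}

theorem wp_scanMasks {W : ℕ → ℕ} {m c : ℕ} (hB : Base N k M s) (h5 : ∀ v < n, s.arr 5 v = W v)
    (h13 : s.reg 13 = m) (h14 : s.reg 14 = c) (hw : n ≤ w) :
    wp w scanMasks s fun s' t => t ≤ n * 8 + 3 ∧ Keep 13 ∅ s s' ∧
      s'.reg 15 = (scan W m n c n).1 := by
  simp only [scanMasks, wp_seq (P := .copy _ _), wp_seq (P := .const _ _), wp_copy, wp_const]
  refine ⟨by omega, ?_⟩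
  refine (wp_for n (fun j s' => Keep 14 ∅ s s' ∧ s'.reg 16 = j ∧
    s'.reg 15 = (scan W m n c j).1 ∧ s'.reg 14 = (scan W m n c j).2) 7 ?_ ?_ ?_).mono ?_
  · rintro j hj s' ⟨hk, h16, h15, h14⟩
    have hB' := hB.of_keep hk (by omega) (by simp)
    have e5 : s'.arr 5 = s.arr 5 := hk.2 5 (by simp)
    have e13 : s'.reg 13 = m := (hk.1 13 (by omega)).trans h13
    refine ⟨by rw [h16, hB'.r0]; exact hj, ?_⟩
    simp only [wp_seq, wp_branch, wp_skip, wp_load, wp_copy, wp_sub, wp_add, reg_setReg,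
      h16, h14, e5, e13, h5 j hj, hB'.r3, hB'.r4]
    simp only [scan]
    simp
    refine ⟨fun hlt => ⟨by omega, ?_, ?_⟩, fun hle => ⟨fun hlt => ⟨by omega, ?_, ?_⟩,
      fun hge => ⟨fun hc => ⟨by omega, ?_, ?_⟩, fun hc => ⟨by omega, ?_, ?_⟩⟩⟩⟩
    · rw [keep_setReg (by omega), keep_setReg (by omega)]; exact hk
    · rw [if_neg (by omega)]; exact ⟨h15, rfl⟩
    · rw [keep_setReg (by omega), keep_setReg (by omega)]; exact hk
    · rw [if_neg (by omega)]; exact ⟨h15, rfl⟩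
    · rw [keep_setReg (by omega), keep_setReg (by omega), keep_setReg (by omega),
        keep_setReg (by omega)]; exact hk
    · rw [if_pos (by omega)]; exact ⟨rfl, rfl⟩
    · rw [keep_setReg (by omega), keep_setReg (by omega)]; exact hk
    · rw [if_neg (by omega)]; exact ⟨h15, rfl⟩
  · rintro s' ⟨hk, h16, -⟩
    have hB' := hB.of_keep hk (by omega) (by simp)
    rw [h16, hB'.r0]
    omega
  · refine ⟨?_, by simp [reg_setReg], by simp [reg_setReg, scan, hB.r0],
      by simp [reg_setReg, scan, h14]⟩
    rw [keep_setReg (by omega), keep_setReg (by omega)]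
    exact Keep.refl
  · rintro s' t ⟨ht, hk, -, h15, -⟩
    exact ⟨by omega, hk.weaken (by omega) subset_rfl, h15⟩

/-- Subtracting the color from the pending flag, truncated at `0`, clears the flags of black
neighbors and leaves those of white neighbors as they are. -/
theorem wp_choose {S : Finset ℕ} {y : ℕ} (hB : Base N k M s) (hS : N.Shows S s)
    (hM : Marks n S s) (h15 : s.reg 15 = y) (hy : y < n) (hw : n ≤ w) :
    wp w choose s fun s' t => t ≤ n * 8 + 7 ∧ Keep 13 {3, 4} s s' ∧
      N.Shows (insert y S) s' ∧ Marks n (insert y S) s' := by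
  simp only [choose, wp_seq (P := .store _ _ _), wp_store, reg_setArr, h15, hB.r4, hB.r5]
  set s₁ := (s.setArr 3 y 2).setArr 4 y 0 with hs₁
  have hk₁ : Keep 24 {3, 4} s s₁ := by
    rw [hs₁, keep_setArr (by simp), keep_setArr (by simp)]
    exact Keep.refl
  have hB₁ := hB.of_keep hk₁ (by omega) (by intro; simp; omega)
  have h3 : s₁.arr 3 = Function.update (s.arr 3) y 2 := by
    simp [hs₁, arr_setArr]
  have h4 : s₁.arr 4 = Function.update (s.arr 4) y 0 := by
    simp [hs₁, arr_setArr]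
  refine (wp_scanNbrs (n := n) (u := y) (A := 4) (C := 4) (nb := N.nb)
      (fun x => s₁.arr 4 x - s₁.arr 2 x) hB₁.r3 hB₁.r4 hB₁.stored
      ((hk₁.1 15 (by omega)).trans h15) (by omega) hy hw (by omega) (N.nodup y)
      (N.length_nb_le y) ?_).mono ?_
  · intro s' x hx hk' h26 hA
    have e2 : s'.arr 2 = s₁.arr 2 := hk'.2 2 (by simp)
    simp only [wp_seq, wp_load, wp_sub, wp_store, reg_setReg, arr_setReg, arr_setArr, h26, hA, e2]
    simp
    rw [keep_setArr (by simp), keep_setReg le_rfl, keep_setReg (by omega), keep_setReg le_rfl]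
    exact Keep.refl
  · rintro s' t ⟨ht, hk, hA⟩
    have hk' : Keep 24 {3, 4} s s' := hk₁.trans (hk.weaken le_rfl (by simp))
    refine ⟨by omega, hk'.weaken (by omega) subset_rfl, ?_, ?_⟩
    · intro v hv
      have hp : N.Pending (insert y S) v ↔ N.Pending S v ∧ ¬ N.Sat y v := by
        simp only [Net.Pending, mem_insert, forall_eq_or_imp]
        tauto
      have hsat : N.Sat y v ↔ y = v ∨ (N.black v ∧ v ∈ N.nb y) := by
        unfold Net.Sat
        exact or_congr Iff.rfl (and_congr Iff.rfl ⟨N.symm v y, N.symm y v⟩)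
      have hb := hB₁.black v hv
      have hSv := hS v hv
      rw [hA, hp, hsat, h4, Function.update_apply]
      by_cases hvy : v = y
      · subst hvy
        simp
      · have hyv : y ≠ v := fun h => hvy h.symm
        by_cases hbv : N.black v <;> by_cases hnv : v ∈ N.nb y <;>
          by_cases hpv : N.Pending S v <;> simp_all
    · intro v hv
      rw [hk.2 3 (by simp), h3, Function.update_apply, hM v hv]
      by_cases hvy : v = y <;> simp [hvy]

theorem wp_searchStep {S : Finset ℕ} {x : ℕ} (hB : Base N k M s) (hS : N.Shows S s)
    (hM : Marks n S s) (h12 : s.reg 12 = x) (hx : x ≤ w) (hw : n + 2 * 2 ^ M ≤ w) :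
    wp w searchStep s fun s' t => t ≤ n * 25 + M * (n * 7 + 11) + x * 6 + 40 ∧
      Keep 12 {3, 4, 5} s s' ∧ N.Shows (N.step M (S, x)).1 s' ∧
      Marks n (N.step M (S, x)).1 s' ∧ s'.reg 12 = (N.step M (S, x)).2 := by
  rw [searchStep, wp_seq]
  refine (wp_computeMasks hB hS hw).mono ?_
  rintro s₁ t₁ ⟨ht₁, hk₁, h5⟩
  rw [wp_seq]
  refine (wp_divMod (hB.of_keep hk₁ (by omega) (by simp)) ((hk₁.1 12 (by omega)).trans h12)
    hx).mono ?_
  rintro s₂ t₂ ⟨ht₂, hk₂, -, h18, h12₂⟩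
  rw [wp_seq, wp_copy, wp_seq, h18]
  have hk₂' : Keep 12 ∅ s₁ (s₂.setReg 13 (x % 2 ^ M)) := by
    rw [keep_setReg (by omega)]; exact hk₂
  have hK₂ : Keep 12 {5} s (s₂.setReg 13 (x % 2 ^ M)) :=
    (hk₁.weaken (by omega) subset_rfl).trans (hk₂'.weaken le_rfl (by simp))
  have hx1 : x / 2 ^ M ≤ x := Nat.div_le_self _ _
  refine (wp_divMod (x := x / 2 ^ M) (hB.of_keep hK₂ (by omega) (by simp))
    (by simp [reg_setReg, h12₂]) (by omega)).mono ?_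
  rintro s₃ t₃ ⟨ht₃, hk₃, hr₃, h18₃, h12₃⟩
  rw [wp_seq, wp_copy, wp_seq, h18₃]
  have hK₃ : Keep 12 {5} s (s₃.setReg 14 (x / 2 ^ M % 2 ^ M)) := by
    rw [keep_setReg (by omega)]
    exact hK₂.trans (hk₃.weaken le_rfl (by simp))
  have h5₃ : (s₃.setReg 14 (x / 2 ^ M % 2 ^ M)).arr 5 = s₁.arr 5 := by
    rw [arr_setReg, hk₃.2 5 (by simp), hk₂'.2 5 (by simp)]
  refine (wp_scanMasks (W := N.mask M S) (m := x % 2 ^ M) (c := x / 2 ^ M % 2 ^ M)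
    (hB.of_keep hK₃ (by omega) (by simp)) (by rw [h5₃]; exact h5) ?_ (by simp [reg_setReg])
    (by omega)).mono ?_
  · rw [reg_setReg, if_neg (by omega), hr₃ 13 (by omega) (by omega), reg_setReg, if_pos rfl]
  rintro s₄ t₄ ⟨ht₄, hk₄, h15⟩
  have hK₄ : Keep 12 {5} s s₄ := hK₃.trans (hk₄.weaken (by omega) (by simp))
  have hB₄ := hB.of_keep hK₄ (by omega) (by simp)
  have h12₄ : s₄.reg 12 = x / 2 ^ M / 2 ^ M := by
    rw [hk₄.1 12 (by omega), reg_setReg, if_neg (by omega), h12₃]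
  have hS₄ : N.Shows S s₄ := by
    unfold Net.Shows
    rw [hK₄.2 4 (by simp)]
    exact hS
  have hM₄ : Marks n S s₄ := by
    unfold Marks
    rw [hK₄.2 3 (by simp)]
    exact hM
  rw [wp_branch]
  refine ⟨fun hy => ?_, fun hy => ?_⟩
  · rw [hB₄.r0] at hy
    refine (wp_choose hB₄ hS₄ hM₄ rfl hy (by omega)).mono ?_
    rintro s₅ t₅ ⟨ht₅, hk₅, hS₅, hM₅⟩
    rw [h15] at hy hS₅ hM₅
    refine ⟨by omega, (hK₄.weaken le_rfl (by simp)).trans (hk₅.weaken (by omega) ?_), ?_, ?_, ?_⟩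
    · intro; simp; omega
    · simpa only [Net.step, if_pos hy] using hS₅
    · simpa only [Net.step, if_pos hy] using hM₅
    · rw [hk₅.1 12 (by omega), h12₄, Net.step]
  · rw [hB₄.r0, h15] at hy
    rw [wp_skip]
    refine ⟨by omega, hK₄.weaken le_rfl (by simp), ?_, ?_, ?_⟩
    · simpa only [Net.step, if_neg hy] using hS₄
    · simpa only [Net.step, if_neg hy] using hM₄
    · rw [h12₄, Net.step]

end Step

/-- Sets up the demands and an empty solution. -/
def initArrays (a : SignType) : Prog :=
  .seq (.const 16 0) <| .loop 16 0 <|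
  .seq (if a = 1 then .const 18 1 else .load 18 2 16) <| .seq (.store 4 16 18) <|
  .seq (.store 3 16 3) (.add 16 16 3)

/-- Counts the pending vertices in register `18`. -/
def countPending : Prog :=
  .seq (.const 18 0) <| .seq (.const 16 0) <| .loop 16 0 <|
  .seq (.load 19 4 16) <| .seq (.add 18 18 19) (.add 16 16 3)

/-- Performs the search that is encoded by the number in register `9`. -/
def trial (a : SignType) : Prog :=
  .seq (initArrays a) <| .seq (.copy 12 9) <| .seq (.const 11 0) <|
  .seq (.loop 11 1 (.seq searchStep (.add 11 11 3))) <| .seq countPending <|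
  .branch 4 18 (.add 9 9 3) (.seq (.copy 9 8) (.const 10 1))

/-- `20 := 18 * 19`. -/
def mulProg : Prog :=
  .seq (.const 20 0) <| .seq (.const 21 0) <|
  .loop 21 18 (.seq (.add 20 20 19) (.add 21 21 3))

/-- `20 := 2 ^ 18`. -/
def powProg : Prog :=
  .seq (.const 20 1) <| .seq (.const 21 0) <|
  .loop 21 18 (.seq (.add 20 20 20) (.add 21 21 3))

/-- Computes the constants. -/
def prelude : Prog :=
  .seq (.const 3 1) <| .seq (.const 5 2) <| .seq (.add 18 1 3) <| .seq (.add 19 2 3) <|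
  .seq mulProg <| .seq (.copy 22 20) <| .seq (.copy 18 20) <| .seq powProg <|
  .seq (.copy 6 20) <| .seq (.sub 7 6 3) <| .seq (.copy 18 1) <| .seq (.add 19 22 22) <|
  .seq mulProg <| .seq (.copy 18 20) <| .seq powProg (.copy 8 20)

/-- The algorithm. -/
def minusDomProg (a : SignType) : Prog :=
  .seq prelude <| .seq (.loop 9 8 (trial a)) (.copy 0 10)

/-! ### A complete trial, and arithmetic without multiplication -/

section Trial

variable {n d : ℕ} {N : Net n d} {k M w : ℕ} {s : State} {a : SignType}

theorem Net.step_snd_le (N : Net n d) (M : ℕ) (p : Finset ℕ × ℕ) : (N.step M p).2 ≤ p.2 :=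
  (Nat.div_le_self _ _).trans (Nat.div_le_self _ _)

theorem Net.iterate_step_snd_le (N : Net n d) (M i : ℕ) (p : Finset ℕ × ℕ) :
    ((N.step M)^[i] p).2 ≤ p.2 := by
  induction i with
  | zero => exact le_rfl
  | succ i ih =>
    rw [Function.iterate_succ_apply']
    exact (N.step_snd_le M _).trans ih

theorem wp_initArrays (hB : Base N k M s) (hneed : ∀ v < n, N.need v ↔ N.black v ∨ a = 1)
    (hw : n + 1 ≤ w) :
    wp w (initArrays a) s fun s' t => t ≤ n * 5 + 2 ∧ Keep 16 {3, 4} s s' ∧ N.Shows ∅ s' ∧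
      Marks n ∅ s' := by
  simp only [initArrays, wp_seq (P := .const _ _), wp_const]
  refine ⟨by omega, ?_⟩
  have hpend : ∀ v < n, N.Pending ∅ v ↔ N.black v ∨ a = 1 := fun v hv => by
    simp [Net.Pending, hv, hneed v hv]
  refine (wp_for n (fun j s' => Keep 16 {3, 4} s s' ∧ s'.reg 16 = j ∧
    ∀ v < j, (N.Pending ∅ v → s'.arr 4 v = 1) ∧ (¬ N.Pending ∅ v → s'.arr 4 v = 0) ∧
      s'.arr 3 v = 1) 4 ?_ ?_ ?_).mono ?_
  · rintro j hj s' ⟨hk, h16, hA⟩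
    have hB' := hB.of_keep hk (by omega) (by intro; simp; omega)
    refine ⟨by rw [h16, hB'.r0]; exact hj, ?_⟩
    have hb := hB'.black j hj
    have hinit : wp w (if a = 1 then Prog.const 18 1 else .load 18 2 16) s' fun s'' t => t = 1 ∧
        ∃ u, s'' = s'.setReg 18 u ∧ (N.Pending ∅ j → u = 1) ∧ (¬ N.Pending ∅ j → u = 0) := by
      split_ifs with ha
      · rw [wp_const]
        exact ⟨by omega, rfl, 1, rfl, fun _ => rfl, fun h =>
          absurd ((hpend j hj).2 (Or.inr ha)) h⟩
      · rw [wp_load, h16]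
        refine ⟨rfl, _, rfl, fun h => hb.1 ?_, fun h => hb.2 fun h' =>
          h ((hpend j hj).2 (Or.inl h'))⟩
        simpa [ha] using (hpend j hj).1 h
    rw [wp_seq]
    refine hinit.mono ?_
    rintro _ t ⟨rfl, u, rfl, hu1, hu0⟩
    simp only [wp_seq, wp_add, wp_store, reg_setReg, arr_setReg, arr_setArr, reg_setArr, h16,
      hB'.r3]
    simp
    refine ⟨by omega, ?_, ?_⟩
    · rw [keep_setReg le_rfl, keep_setArr (by simp), keep_setArr (by simp),
        keep_setReg (by omega)]
      exact hk
    · intro v hv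
      rw [Function.update_apply, Function.update_apply]
      by_cases hvj : v = j
      · subst hvj
        rw [if_pos rfl, if_pos rfl]
        exact ⟨hu1, hu0, rfl⟩
      · rw [if_neg hvj, if_neg hvj]
        exact hA v (by omega)
  · rintro s' ⟨hk, h16, -⟩
    have hB' := hB.of_keep hk (by omega) (by intro; simp; omega)
    rw [h16, hB'.r0]
    omega
  · refine ⟨?_, by simp [reg_setReg], by simp⟩
    rw [keep_setReg le_rfl]
    exact Keep.refl
  · rintro s' t ⟨ht, hk, -, hA⟩
    refine ⟨by omega, hk, fun v hv => ⟨(hA v hv).1, (hA v hv).2.1⟩, fun v hv => ?_⟩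
    simpa using (hA v hv).2.2

theorem Net.rank_eq_zero_iff (N : Net n d) (S : Finset ℕ) :
    N.rank S n = 0 ↔ ∀ v, ¬ N.Pending S v := by
  classical
  rw [rank, card_eq_zero, filter_eq_empty_iff]
  exact ⟨fun h v hv => h (mem_range.2 hv.1) hv, fun h v _ => h v⟩

theorem wp_countPending {S : Finset ℕ} (hB : Base N k M s) (hS : N.Shows S s) (hw : n ≤ w) :
    wp w countPending s fun s' t => t ≤ n * 4 + 3 ∧ Keep 16 ∅ s s' ∧
      s'.reg 18 = N.rank S n := by
  classical
  simp only [countPending, wp_seq (P := .const _ _), wp_const]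
  refine ⟨by omega, by omega, ?_⟩
  refine (wp_for n (fun j s' => Keep 16 ∅ s s' ∧ s'.reg 16 = j ∧ s'.reg 18 = N.rank S j) 3
    ?_ ?_ ?_).mono ?_
  · rintro j hj s' ⟨hk, h16, h18⟩
    have hB' := hB.of_keep hk (by omega) (by simp)
    refine ⟨by rw [h16, hB'.r0]; exact hj, ?_⟩
    have h4 : s'.arr 4 = s.arr 4 := hk.2 4 (by simp)
    have hval : s.arr 4 j = if N.Pending S j then 1 else 0 := by
      split_ifs with h
      · exact (hS j hj).1 h
      · exact (hS j hj).2 h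
    have hle : N.rank S (j + 1) ≤ j + 1 := by
      rw [Net.rank]
      exact (card_filter_le _ _).trans (by rw [card_range])
    rw [N.rank_succ] at hle
    simp only [wp_seq, wp_load, wp_add, reg_setReg, h16, h18, h4, hval, hB'.r3]
    simp
    refine ⟨by omega, by omega, ?_, (N.rank_succ S j).symm⟩
    rw [keep_setReg (by omega), keep_setReg (by omega), keep_setReg (by omega)]
    exact hk
  · rintro s' ⟨hk, h16, -⟩
    have hB' := hB.of_keep hk (by omega) (by simp)
    rw [h16, hB'.r0]
    omega
  · refine ⟨?_, by simp [reg_setReg], by simp [reg_setReg, Net.rank]⟩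
    rw [keep_setReg (by omega), keep_setReg (by omega)]
    exact Keep.refl
  · rintro s' t ⟨ht, hk, -, h18⟩
    exact ⟨by omega, hk, h18⟩

/-- A failed trial moves on to the next number. A successful one puts the upper limit into register
`9`, which ends the outer loop while array `3` still holds the solution. -/
theorem wp_trial {x : ℕ} (hB : Base N k M s) (hneed : ∀ v < n, N.need v ↔ N.black v ∨ a = 1)
    (h9 : s.reg 9 = x) (hx : x < 2 ^ (M * (2 * k)))
    (hw : n + 2 * 2 ^ M + 2 ^ (M * (2 * k)) ≤ w) (hk : k ≤ w) :
    wp w (trial a) s fun s' t =>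
      t ≤ k * (n * 25 + M * (n * 7 + 11) + 2 ^ (M * (2 * k)) * 6 + 42) + n * 9 + 15 ∧
      Base N k M s' ∧
      (((∃ v, N.Pending ((N.step M)^[k] (∅, x)).1 v) ∧ s'.reg 9 = x + 1 ∧
          s'.reg 10 = s.reg 10) ∨
        ((∀ v, ¬ N.Pending ((N.step M)^[k] (∅, x)).1 v) ∧ s'.reg 9 = 2 ^ (M * (2 * k)) ∧
          s'.reg 10 = 1 ∧ Marks n ((N.step M)^[k] (∅, x)).1 s')) := by
  rw [trial, wp_seq]
  refine (wp_initArrays hB hneed (by omega)).mono ?_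
  rintro s₁ t₁ ⟨ht₁, hk₁, hS₁, hM₁⟩
  rw [wp_seq, wp_copy, wp_seq, wp_const, wp_seq, hk₁.1 9 (by omega), h9]
  refine ⟨by omega, ?_⟩
  have hK₁ : Keep 11 {3, 4, 5} s s₁ := hk₁.weaken (by omega) (by intro; simp; omega)
  refine (wp_for k (fun i s' => Keep 11 {3, 4, 5} s s' ∧ s'.reg 11 = i ∧
    N.Shows ((N.step M)^[i] (∅, x)).1 s' ∧ Marks n ((N.step M)^[i] (∅, x)).1 s' ∧
    s'.reg 12 = ((N.step M)^[i] (∅, x)).2)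
    (n * 25 + M * (n * 7 + 11) + 2 ^ (M * (2 * k)) * 6 + 41) ?_ ?_ ?_).mono ?_
  · rintro i hi s' ⟨hk', h11, hS, hM, h12⟩
    have hB' := hB.of_keep hk' (by omega) subset_rfl
    refine ⟨by rw [h11, hB'.r1]; exact hi, ?_⟩
    -- The dividend never grows, so the range of `x` bounds the cost of the divisions in every step.
    have hle := N.iterate_step_snd_le M i (∅, x)
    simp only at hle
    rw [wp_seq]
    refine (wp_searchStep hB' hS hM h12 (by omega) (by omega)).mono ?_
    rintro s₂ t₂ ⟨ht₂, hk₂, hS₂, hM₂, h12₂⟩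
    have hK₂ : Keep 11 {3, 4, 5} s s₂ := hk'.trans (hk₂.weaken (by omega) subset_rfl)
    have hB₂ := hB.of_keep hK₂ (by omega) subset_rfl
    have e11 : s₂.reg 11 = i := (hk₂.1 11 (by omega)).trans h11
    rw [wp_add, e11, hB₂.r3, Function.iterate_succ_apply']
    refine ⟨by omega, by omega, ?_, by simp [reg_setReg], hS₂, hM₂, ?_⟩
    · rw [keep_setReg le_rfl]
      exact hK₂
    · rw [reg_setReg, if_neg (by omega)]
      exact h12₂
  · rintro s' ⟨hk', h11, -⟩
    have hB' := hB.of_keep hk' (by omega) subset_rfl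
    rw [h11, hB'.r1]
    omega
  · refine ⟨?_, by simp [reg_setReg], hS₁, hM₁, by simp [reg_setReg]⟩
    rw [keep_setReg le_rfl, keep_setReg (by omega)]
    exact hK₁
  · rintro s₂ t₂ ⟨ht₂, hk₂, -, hS₂, hM₂, -⟩
    have ht₂ : t₂ ≤ k * (n * 25 + M * (n * 7 + 11) + 2 ^ (M * (2 * k)) * 6 + 42) + 1 := ht₂
    have hB₂ := hB.of_keep hk₂ (by omega) subset_rfl
    rw [wp_seq]
    refine (wp_countPending hB₂ hS₂ (by omega)).mono ?_
    rintro s₃ t₃ ⟨ht₃, hk₃, h18⟩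
    have hK₃ : Keep 11 {3, 4, 5} s s₃ := hk₂.trans (hk₃.weaken (by omega) (by simp))
    have hB₃ := hB.of_keep hK₃ (by omega) subset_rfl
    have e9 : s₃.reg 9 = x := (hK₃.1 9 (by omega)).trans h9
    have hB₄ : ∀ {s' : State}, Keep 9 ∅ s₃ s' → Base N k M s' := fun h =>
      hB₃.of_keep h le_rfl (by simp)
    have hz := N.rank_eq_zero_iff ((N.step M)^[k] (∅, x)).1
    rw [wp_branch]
    refine ⟨fun hpos => ?_, fun hzero => ?_⟩
    · rw [hB₃.r4, h18] at hpos
      rw [wp_add, e9, hB₃.r3]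
      refine ⟨by omega, by omega, hB₄ ((keep_setReg le_rfl).2 Keep.refl), Or.inl ⟨?_, ?_, ?_⟩⟩
      · by_contra! h
        exact hpos.ne' (hz.2 h)
      · rw [reg_setReg, if_pos rfl]
      · rw [reg_setReg, if_neg (by omega), hK₃.1 10 (by omega)]
    · rw [hB₃.r4, h18] at hzero
      rw [wp_seq, wp_copy, wp_const]
      refine ⟨by omega, by omega,
        hB₄ ((keep_setReg (by omega)).2 ((keep_setReg le_rfl).2 Keep.refl)),
        Or.inr ⟨hz.1 (by omega), ?_, ?_, ?_⟩⟩
      · rw [reg_setReg, if_neg (by omega), reg_setReg, if_pos rfl, hB₃.r8]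
      · rw [reg_setReg, if_pos rfl]
      · unfold Marks
        rw [arr_setReg, arr_setReg, hk₃.2 3 (by simp)]
        exact hM₂

theorem wp_mulProg {x y : ℕ} (h3 : s.reg 3 = 1) (h18 : s.reg 18 = x) (h19 : s.reg 19 = y)
    (hx : x ≤ w) (hxy : x * y ≤ w) :
    wp w mulProg s fun s' t => t ≤ x * 3 + 3 ∧ Keep 20 ∅ s s' ∧
      s'.reg 20 = x * y ∧ s'.reg 22 = s.reg 22 := by
  simp only [mulProg, wp_seq (P := .const _ _), wp_const]
  refine ⟨by omega, by omega, ?_⟩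
  refine (wp_for x (fun j s' => Keep 20 ∅ s s' ∧ s'.reg 21 = j ∧ s'.reg 20 = j * y ∧
    s'.reg 22 = s.reg 22) 2 ?_ ?_ ?_).mono ?_
  · rintro j hj s' ⟨hk, h21, h20, h22⟩
    have e18 : s'.reg 18 = x := (hk.1 18 (by omega)).trans h18
    have e19 : s'.reg 19 = y := (hk.1 19 (by omega)).trans h19
    have e3 : s'.reg 3 = 1 := (hk.1 3 (by omega)).trans h3
    refine ⟨by omega, ?_⟩
    have hle : (j + 1) * y ≤ x * y := Nat.mul_le_mul_right y hj
    rw [Nat.succ_mul] at hle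
    simp only [wp_seq, wp_add, reg_setReg, h21, h20, e19, e3]
    simp
    refine ⟨by omega, by omega, ?_, (Nat.succ_mul j y).symm, h22⟩
    rw [keep_setReg (by omega), keep_setReg le_rfl]
    exact hk
  · rintro s' ⟨hk, h21, -⟩
    have e18 : s'.reg 18 = x := (hk.1 18 (by omega)).trans h18
    omega
  · refine ⟨?_, by simp [reg_setReg], by simp [reg_setReg], by simp [reg_setReg]⟩
    rw [keep_setReg (by omega), keep_setReg le_rfl]
    exact Keep.refl
  · rintro s' t ⟨ht, hk, -, h20, h22⟩
    exact ⟨by omega, hk, h20, h22⟩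

theorem wp_powProg {x : ℕ} (h3 : s.reg 3 = 1) (h18 : s.reg 18 = x) (hx : 2 ^ x ≤ w) :
    wp w powProg s fun s' t => t ≤ x * 3 + 3 ∧ Keep 20 ∅ s s' ∧
      s'.reg 20 = 2 ^ x ∧ s'.reg 22 = s.reg 22 := by
  have hxw : x < w := Nat.lt_two_pow_self.trans_le hx
  simp only [powProg, wp_seq (P := .const _ _), wp_const]
  refine ⟨by omega, by omega, ?_⟩
  refine (wp_for x (fun j s' => Keep 20 ∅ s s' ∧ s'.reg 21 = j ∧ s'.reg 20 = 2 ^ j ∧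
    s'.reg 22 = s.reg 22) 2 ?_ ?_ ?_).mono ?_
  · rintro j hj s' ⟨hk, h21, h20, h22⟩
    have e18 : s'.reg 18 = x := (hk.1 18 (by omega)).trans h18
    have e3 : s'.reg 3 = 1 := (hk.1 3 (by omega)).trans h3
    refine ⟨by omega, ?_⟩
    have hle : 2 ^ (j + 1) ≤ 2 ^ x := Nat.pow_le_pow_right (by omega) hj
    rw [pow_succ] at hle
    simp only [wp_seq, wp_add, reg_setReg, h21, h20, e3]
    simp
    refine ⟨by omega, by omega, ?_, by rw [pow_succ]; omega, h22⟩
    rw [keep_setReg (by omega), keep_setReg le_rfl]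
    exact hk
  · rintro s' ⟨hk, h21, -⟩
    have e18 : s'.reg 18 = x := (hk.1 18 (by omega)).trans h18
    omega
  · refine ⟨?_, by simp [reg_setReg], by simp [reg_setReg], by simp [reg_setReg]⟩
    rw [keep_setReg (by omega), keep_setReg le_rfl]
    exact Keep.refl
  · rintro s' t ⟨ht, hk, -, h20, h22⟩
    exact ⟨by omega, hk, h20, h22⟩

end Trial

/-! ### The constants, the outer loop and the total cost -/

section Main

variable {n d k M w : ℕ} {N : Net n d} {s : State} {a : SignType}

theorem wp_prelude (h0 : s.reg 0 = n) (h1 : s.reg 1 = k) (h2 : s.reg 2 = d) (h4 : s.reg 4 = 0)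
    (hst : Stored n N.nb s.arr)
    (hbl : ∀ v < n, (N.black v → s.arr 2 v = 1) ∧ (¬ N.black v → s.arr 2 v = 0))
    (hM : M = (k + 1) * (d + 1)) (hw : 2 + 2 ^ M + 2 ^ (M * (2 * k)) ≤ w) :
    wp w prelude s fun s' t => t ≤ M * 9 + 2 ^ (M * (2 * k)) * 3 + 40 ∧ Base N k M s' ∧
      s'.reg 9 = s.reg 9 ∧ s'.reg 10 = s.reg 10 := by
  have hME : M < 2 ^ M := Nat.lt_two_pow_self
  have hX : M * (2 * k) < 2 ^ (M * (2 * k)) := Nat.lt_two_pow_self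
  have hkM : k + 1 ≤ M := hM ▸ Nat.le_mul_of_pos_right _ (by omega)
  have hdM : d + 1 ≤ M := hM ▸ Nat.le_mul_of_pos_left _ (by omega)
  -- The program forms `M + M` before multiplying by `k`; for `k = 0` the product does not bound it,
  -- and `2M ≤ 2 ^ M` is used instead.
  have hMM : M + M ≤ w := by
    rcases Nat.eq_zero_or_pos k with rfl | hk
    · have h2M : 2 * M ≤ 2 ^ M := by
        obtain ⟨m, rfl⟩ : ∃ m, M = m + 1 := ⟨M - 1, by omega⟩
        have : m < 2 ^ m := Nat.lt_two_pow_self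
        rw [pow_succ]
        omega
      omega
    · have : M ≤ M * (2 * k) := Nat.le_mul_of_pos_right _ (by omega)
      omega
  have hkMM : k * (M + M) = M * (2 * k) := by ring
  simp only [prelude, wp_seq (P := .const _ _), wp_seq (P := .add _ _ _), wp_const, wp_add]
  refine ⟨by omega, by omega, ?_⟩
  simp [reg_setReg, h1, h2]
  refine ⟨by omega, by omega, ?_⟩
  set s₁ := (((s.setReg 3 1).setReg 5 2).setReg 18 (k + 1)).setReg 19 (d + 1) with hs₁
  have a₁ : ∀ A, s₁.arr A = s.arr A := fun A => rfl
  have r₁ : ∀ r < 18, s₁.reg r = if r = 3 then 1 else if r = 5 then 2 else s.reg r := by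
    intro r hr
    rw [hs₁, reg_setReg, if_neg (by omega), reg_setReg, if_neg (by omega), reg_setReg, reg_setReg]
    split_ifs <;> simp_all
  rw [wp_seq]
  refine (wp_mulProg (x := k + 1) (y := d + 1) (by simp [r₁]) (by simp [hs₁, reg_setReg])
    (by simp [hs₁, reg_setReg]) (by omega) (by omega)).mono ?_
  rintro s₂ t₂ ⟨ht₂, hk₂, h20, -⟩
  rw [← hM] at h20
  simp only [wp_seq (P := .copy _ _), wp_copy, reg_setReg, h20]
  simp
  have hk₂' : Keep 18 ∅ s₁ ((s₂.setReg 22 M).setReg 18 M) := by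
    rw [keep_setReg le_rfl, keep_setReg (by omega)]
    exact hk₂.weaken (by omega) subset_rfl
  rw [wp_seq]
  refine (wp_powProg (x := M) ((hk₂'.1 3 (by omega)).trans (by simp [r₁])) (by simp [reg_setReg])
    (by omega)).mono ?_
  rintro s₃ t₃ ⟨ht₃, hk₃, h20₃, h22₃⟩
  have hK₃ : Keep 18 ∅ s₁ s₃ := hk₂'.trans (hk₃.weaken (by omega) subset_rfl)
  have h22 : s₃.reg 22 = M := by simp [h22₃, reg_setReg]
  have h3₃ : s₃.reg 3 = 1 := (hK₃.1 3 (by omega)).trans (by simp [r₁])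
  have h1₃ : s₃.reg 1 = k := (hK₃.1 1 (by omega)).trans (by simp [r₁, h1])
  simp only [wp_seq (P := .copy _ _), wp_seq (P := .sub _ _ _), wp_seq (P := .add _ _ _),
    wp_copy, wp_sub, wp_add, reg_setReg, h20₃, h22, h3₃, h1₃]
  simp
  refine ⟨hMM, ?_⟩
  set s₄ := (((s₃.setReg 6 (2 ^ M)).setReg 7 (2 ^ M - 1)).setReg 18 k).setReg 19 (M + M) with hs₄
  have a₄ : ∀ A, s₄.arr A = s.arr A := fun A => (hK₃.2 A (by simp)).trans (a₁ A)
  have r₄ : ∀ r < 18, s₄.reg r = if r = 6 then 2 ^ M else if r = 7 then 2 ^ M - 1 else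
      if r = 3 then 1 else if r = 5 then 2 else s.reg r := by
    intro r hr
    rw [hs₄, reg_setReg, if_neg (by omega), reg_setReg, if_neg (by omega), reg_setReg,
      reg_setReg, hK₃.1 r hr, r₁ r hr]
    split_ifs <;> first | rfl | omega
  rw [wp_seq]
  refine (wp_mulProg (x := k) (y := M + M) (by simp [r₄]) (by simp [hs₄, reg_setReg])
    (by simp [hs₄, reg_setReg]) (by omega) (by omega)).mono ?_
  rintro s₅ t₅ ⟨ht₅, hk₅, h20₅, -⟩
  rw [hkMM] at h20₅
  rw [wp_seq, wp_copy, h20₅, wp_seq]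
  have hk₅' : Keep 18 ∅ s₄ (s₅.setReg 18 (M * (2 * k))) := by
    rw [keep_setReg le_rfl]
    exact hk₅.weaken (by omega) subset_rfl
  refine (wp_powProg (x := M * (2 * k)) ((hk₅'.1 3 (by omega)).trans (by simp [r₄]))
    (by simp [reg_setReg]) (by omega)).mono ?_
  rintro s₆ t₆ ⟨ht₆, hk₆, h20₆, -⟩
  have hK₆ : Keep 18 ∅ s₄ s₆ := hk₅'.trans (hk₆.weaken (by omega) subset_rfl)
  have r₆ : ∀ r < 18, s₆.reg r = s₄.reg r := hK₆.1
  have a₆ : s₆.arr = s.arr := funext fun A => (hK₆.2 A (by simp)).trans (a₄ A)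
  rw [wp_copy, h20₆]
  refine ⟨by omega, ⟨?_, ?_, ?_, ?_, ?_, ?_, ?_, ?_, ?_, ?_⟩, ?_, ?_⟩
  · simp [reg_setReg, r₆, r₄, h0]
  · simp [reg_setReg, r₆, r₄, h1]
  · simp [reg_setReg, r₆, r₄]
  · simp [reg_setReg, r₆, r₄, h4]
  · simp [reg_setReg, r₆, r₄]
  · simp [reg_setReg, r₆, r₄]
  · simp [reg_setReg, r₆, r₄]
  · simp [reg_setReg]
  · rw [arr_setReg, a₆]
    exact hst
  · rw [arr_setReg, a₆]
    exact hbl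
  · simp [reg_setReg, r₆, r₄]
  · simp [reg_setReg, r₆, r₄]

/-- The result of the whole search. -/
def Result (N : Net n d) (k M : ℕ) (s : State) : Prop :=
  (s.reg 0 = 0 ∧ ∀ x < 2 ^ (M * (2 * k)), ∃ v, N.Pending ((N.step M)^[k] (∅, x)).1 v) ∨
  (s.reg 0 = 1 ∧ ∃ S : Finset ℕ, #S ≤ k ∧ (∀ v, ¬ N.Pending S v) ∧ Marks n S s)

/-- Invariant: either all numbers below register `9` have failed, or the flag in register `10` is
set and array `3` marks a solution. As success ends the loop early, the number of rounds is only
bounded, by a variant. -/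
theorem wp_minusDomProg (h0 : s.reg 0 = n) (h1 : s.reg 1 = k) (h2 : s.reg 2 = d)
    (h4 : s.reg 4 = 0) (h9 : s.reg 9 = 0) (h10 : s.reg 10 = 0) (hst : Stored n N.nb s.arr)
    (hbl : ∀ v < n, (N.black v → s.arr 2 v = 1) ∧ (¬ N.black v → s.arr 2 v = 0))
    (hneed : ∀ v < n, N.need v ↔ N.black v ∨ a = 1)
    (hM : M = (k + 1) * (d + 1)) (hw : 2 + n + 2 * 2 ^ M + 2 ^ (M * (2 * k)) ≤ w) :
    wp w (minusDomProg a) s fun s' t =>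
      t ≤ 2 ^ (M * (2 * k)) * (k * (n * 25 + M * (n * 7 + 11) + 2 ^ (M * (2 * k)) * 6 + 42) +
        n * 9 + 16) + (M * 9 + 2 ^ (M * (2 * k)) * 3 + 42) ∧ Result N k M s' := by
  have hkM : k + 1 ≤ M := hM ▸ Nat.le_mul_of_pos_right _ (by omega)
  have hME : M < 2 ^ M := Nat.lt_two_pow_self
  rw [minusDomProg, wp_seq]
  refine (wp_prelude h0 h1 h2 h4 hst hbl hM (by omega)).mono ?_
  rintro s₁ t₁ ⟨ht₁, hB₁, e9, e10⟩
  rw [h9] at e9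
  rw [h10] at e10
  rw [wp_seq]
  refine (wp_while (fun s => Base N k M s ∧ s.reg 9 ≤ 2 ^ (M * (2 * k)) ∧
    ((s.reg 10 = 0 ∧ ∀ x < s.reg 9, ∃ v, N.Pending ((N.step M)^[k] (∅, x)).1 v) ∨
      (s.reg 10 = 1 ∧ s.reg 9 = 2 ^ (M * (2 * k)) ∧
        ∃ S : Finset ℕ, #S ≤ k ∧ (∀ v, ¬ N.Pending S v) ∧ Marks n S s)))
    (fun s => 2 ^ (M * (2 * k)) - s.reg 9)
    (k * (n * 25 + M * (n * 7 + 11) + 2 ^ (M * (2 * k)) * 6 + 42) + n * 9 + 15) ?_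
    (2 ^ (M * (2 * k))) s₁ ?_ ?_).mono ?_
  · rintro s ⟨hB, h9, hI⟩ hlt
    rw [hB.r8] at hlt
    have hI : s.reg 10 = 0 ∧ ∀ x < s.reg 9, ∃ v, N.Pending ((N.step M)^[k] (∅, x)).1 v := by
      rcases hI with hI | hI
      · exact hI
      · omega
    refine (wp_trial hB hneed rfl hlt (by omega) (by omega)).mono ?_
    rintro s' t ⟨ht, hB', ⟨hfail, h9', h10'⟩ | ⟨hok, h9', h10', hmarks⟩⟩
    · refine ⟨ht, ⟨hB', by omega, Or.inl ⟨by omega, ?_⟩⟩, by omega⟩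
      intro x hx
      rcases Nat.lt_succ_iff_lt_or_eq.1 (h9' ▸ hx) with hx | rfl
      · exact hI.2 x hx
      · exact hfail
    · exact ⟨ht, ⟨hB', by omega, Or.inr ⟨h10', h9', _, N.card_iterate_step_le M k _, hok,
        hmarks⟩⟩, by omega⟩
  · exact ⟨hB₁, by omega, Or.inl ⟨e10, fun x hx => by omega⟩⟩
  · omega
  · rintro s₂ t₂ ⟨ht₂, ⟨hB, h9, hI⟩, hn⟩
    have ht₂ : t₂ ≤ 2 ^ (M * (2 * k)) * (k * (n * 25 + M * (n * 7 + 11) +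
      2 ^ (M * (2 * k)) * 6 + 42) + n * 9 + 16) + 1 := ht₂
    rw [hB.r8] at hn
    rw [wp_copy]
    refine ⟨by omega, ?_⟩
    rcases hI with ⟨h10, hI⟩ | ⟨h10, -, hI⟩
    · exact Or.inl ⟨by rw [reg_setReg, if_pos rfl, h10], fun x hx => hI x (by omega)⟩
    · exact Or.inr ⟨by rw [reg_setReg, if_pos rfl, h10], hI⟩

end Main

/-- The factor in the bounds on time and words. -/
def costFactor (d k : ℕ) : ℕ :=
  300 * ((k + 1) * ((k + 1) * (d + 1) + 1) * (2 ^ ((k + 1) * (d + 1)) + 1) *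
    (2 ^ ((k + 1) * (d + 1) * (2 * k)) + 1) * (2 ^ ((k + 1) * (d + 1) * (2 * k)) + 1))

theorem computable_costFactor : Computable₂ costFactor := by
  have hpow : Primrec₂ ((· ^ ·) : ℕ → ℕ → ℕ) := Primrec₂.unpaired'.1 Nat.Primrec.pow
  have hk1 : Primrec fun p : ℕ × ℕ => p.2 + 1 := Primrec.succ.comp Primrec.snd
  have hM : Primrec fun p : ℕ × ℕ => (p.2 + 1) * (p.1 + 1) :=
    Primrec.nat_mul.comp hk1 (Primrec.succ.comp Primrec.fst)
  have hE : Primrec fun p : ℕ × ℕ => 2 ^ ((p.2 + 1) * (p.1 + 1)) + 1 :=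
    Primrec.succ.comp (hpow.comp (Primrec.const 2) hM)
  have hX : Primrec fun p : ℕ × ℕ => 2 ^ ((p.2 + 1) * (p.1 + 1) * (2 * p.2)) + 1 :=
    Primrec.succ.comp (hpow.comp (Primrec.const 2)
      (Primrec.nat_mul.comp hM (Primrec.nat_mul.comp (Primrec.const 2) Primrec.snd)))
  have h : Primrec fun p : ℕ × ℕ => costFactor p.1 p.2 :=
    Primrec.nat_mul.comp (Primrec.const 300) <| Primrec.nat_mul.comp (Primrec.nat_mul.comp
      (Primrec.nat_mul.comp (Primrec.nat_mul.comp hk1 (Primrec.succ.comp hM)) hE) hX) hX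
  exact h.to_comp

theorem words_le (k M E X n : ℕ) :
    2 + n + 2 * E + X ≤ 300 * ((k + 1) * (M + 1) * (E + 1) * (X + 1) * (X + 1)) * (n + 1) := by
  have h1 : (E + 1) * (X + 1) * (n + 1) ≤
      (k + 1) * (M + 1) * (E + 1) * (X + 1) * (X + 1) * (n + 1) := by
    calc (E + 1) * (X + 1) * (n + 1)
        ≤ ((k + 1) * (M + 1) * (X + 1)) * ((E + 1) * (X + 1) * (n + 1)) :=
          Nat.le_mul_of_pos_left _ (by positivity)
      _ = _ := by ring
  have h2 : E + X + n + 1 ≤ (E + 1) * (X + 1) * (n + 1) := by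
    nlinarith [Nat.zero_le (E * X), Nat.zero_le (E * X * n), Nat.zero_le (E * n),
      Nat.zero_le (X * n)]
  rw [Nat.mul_assoc 300]
  omega

/-- Here `X` is the number of trials. It enters squared because each trial also divides numbers
below `X` by repeated subtraction. The factor `E + 1` serves only the word size. -/
theorem time_le (k M E X n : ℕ) :
    X * (k * (n * 25 + M * (n * 7 + 11) + X * 6 + 42) + n * 9 + 16) + (M * 9 + X * 3 + 42) ≤
      300 * ((k + 1) * (M + 1) * (E + 1) * (X + 1) * (X + 1)) * (n + 1) := by
  have h1 : n * 25 + M * (n * 7 + 11) + X * 6 + 42 ≤ 50 * ((M + 1) * (X + 1) * (n + 1)) := by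
    nlinarith [Nat.zero_le (M * X), Nat.zero_le (M * X * n), Nat.zero_le (M * n),
      Nat.zero_le (X * n)]
  have h2 : n * 9 + 16 ≤ 50 * ((M + 1) * (X + 1) * (n + 1)) := by
    nlinarith [Nat.zero_le (M * X), Nat.zero_le (M * X * n), Nat.zero_le (M * n),
      Nat.zero_le (X * n)]
  have h3 : M * 9 + X * 3 + 42 ≤ 50 * ((M + 1) * (X + 1) * (n + 1)) := by
    nlinarith [Nat.zero_le (M * X), Nat.zero_le (M * X * n), Nat.zero_le (M * n),
      Nat.zero_le (X * n)]
  set P := (M + 1) * (X + 1) * (n + 1) with hP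
  calc X * (k * (n * 25 + M * (n * 7 + 11) + X * 6 + 42) + n * 9 + 16) + (M * 9 + X * 3 + 42)
      ≤ X * (k * (50 * P) + 50 * P) + 50 * P := by
        rw [Nat.add_assoc (k * _)]
        gcongr
    _ ≤ X * (k * (50 * P) + 50 * P) + (k * (50 * P) + 50 * P) := by omega
    _ = 50 * ((k + 1) * (X + 1) * P) := by ring
    _ ≤ 300 * ((k + 1) * (X + 1) * P) * (E + 1) := by
        nlinarith [Nat.zero_le ((k + 1) * (X + 1) * P), Nat.zero_le ((k + 1) * (X + 1) * P * E)]
    _ = _ := by rw [hP]; ring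

end MinusDom

open MinusDom in
theorem MinusDom.exec_minusDomProg (a : SignType) (d k n : ℕ) (G : SimpleGraph (Fin n))
    (B : Set (Fin n)) (L : AdjList G) (hG : IsDegenerate G d) :
    ∃ (s : State) (t : ℕ),
      Exec (costFactor d k * (n + 1)) (minusDomProg a) (initState d k L B) s t ∧
      t ≤ costFactor d k * (n + 1) ∧ CorrectOutput a k G B s := by
  classical
  obtain ⟨s, t, hex, ht, hres⟩ := wp_minusDomProg (w := costFactor d k * (n + 1))
    (N := netOf a B L hG) (s := initState d k L B) (a := a) (k := k) rfl rfl rfl rfl rfl rfl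
    (stored_initState L)
    (fun v _ => ⟨fun h => by simp [initState]; exact h, fun h => by
      simp [initState]; exact fun hv hb => h ⟨hv, hb⟩⟩)
    (fun v _ => Iff.rfl) rfl (words_le k _ _ _ n)
  refine ⟨s, t, hex, ht.trans (time_le k _ _ _ n), ?_⟩
  rcases hres with ⟨h0, hfail⟩ | ⟨h0, S, hcard, hdom, hmarks⟩
  · refine Or.inr ⟨h0, ?_⟩
    rintro ⟨f, hf, hs⟩
    obtain ⟨D, hD, hDk, hcov⟩ := exists_dominating (d := d) (L := L) (hG := hG) hf hs
    -- A solution would make one of the trials succeed, starting from the empty set, but all of them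
    -- failed.
    obtain ⟨x, hx, hx'⟩ := (netOf a B L hG).exists_iterate le_rfl k le_rfl ∅ D hD hDk hcov
    obtain ⟨v, hv⟩ := hfail x hx
    exact hx' v hv
  · refine Or.inl ⟨h0, _, isMinusDomination_of_dominating hdom, size_indicator_le hcard, ?_⟩
    intro v
    rw [hmarks v v.2]
    split_ifs <;> decide

theorem mainTheorem3 (a : SignType) :
    ∃ (P : MinusDom.Prog) (c : ℕ → ℕ → ℕ), Computable₂ c ∧
      ∀ (d k n : ℕ) (G : SimpleGraph (Fin n)) (B : Set (Fin n)) (L : MinusDom.AdjList G),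
        MinusDom.IsDegenerate G d →
          ∃ (s : MinusDom.State) (t : ℕ),
            MinusDom.Exec (c d k * (n + 1)) P (MinusDom.initState d k L B) s t ∧
            t ≤ c d k * (n + 1) ∧
            MinusDom.CorrectOutput a k G B s :=
  ⟨MinusDom.minusDomProg a, MinusDom.costFactor, MinusDom.computable_costFactor,
    fun d k n G B L hG => MinusDom.exec_minusDomProg a d k n G B L hG⟩
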